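/- Let $N\in\mathbb N$, $1<p<N$, $p^*=Np/(N-p)$, and let $\Omega$ be either $\mathbb R^N$ or a ball $B_R(0)\subset\mathbb R^N$, $R>0$. Let $W_0^{1,p}(\Omega)$ be the closure of $C_c^\infty(\Omega)$ in the norm $\|u\|=\big(\|u\|_{L^p}^p+\sum_i\|D_iu\|_{L^p}^p\big)^{1/p}$. Let $j:\mathbb R\times[0,\infty)\to\mathbb R$ have continuous partial derivatives $j_s(s,t)$, $j_t(s,t)$ (one-sided in $t$ at $t=0$), and suppose that there are a constant $\alpha_0>0$ and nondecreasing continuous functions $\alpha,\beta,\gamma:[0,\infty)\to[0,\infty)$ such that, for all $s\in\mathbb R$ and $\xi\in\mathbb R^N$, $$\alpha_0|\xi|^p\le j(s,|\xi|)\le\alpha(|s|)|\xi|^p,\qquad |j_s(s,|\xi|)|\le\beta(|s|)|\xi|^p,\qquad |j_t(s,|\xi|)|\le\gamma(|s|)|\xi|^{p-1}.$$ Let $(x,s)\mapsto f(|x|,s)$ be a Carathéodory function on $\Omega\times\mathbb R$ such that, for some $C>0$ and some radial $a\in L^{Np/(N(p-1)+p)}(\Omega)$, $|f(|x|,s)|\le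 a(|x|)+C|s|^{p^*-1}$ for a.e. $x\in\Omega$ and all $s\in\mathbb R$; let $F(|x|,s)=\int_0^s f(|x|,\tau)\,d\tau$. Let $g:\mathbb R\to\mathbb R$ be continuous with $|g(s)|\le C|s|^{p-1}+C|s|^{p^*-1}$ for some $C>0$ and all $s\in\mathbb R$; let $G(s)=\int_0^s g(\tau)\,d\tau$. Define $$\mathcal E(u)=\int_\Omega j(u,|Du|)-\int_\Omega F(|x|,u)\in\mathbb R\cup\{+\infty\},\qquad \mathcal C=\Big\{u\in W_0^{1,p}(\Omega):\int_\Omega G(u)=1\Big\},\qquad m=\inf_{v\in\mathcal C}\mathcal E(v).$$ Then: (a) For every $u\in W_0^{1,p}(\Omega)$ the functions $F(|x|,u)$ and $G(u)$ are integrable on $\Omega$, and the functional $\mathcal E^*:W_0^{1,p}(\Omega)\to\mathbb R\cup\{+\infty\}$, equal to $\mathcal E$ on $\mathcal C$ and to $+\infty$ off $\mathcal C$, is lower semicontinuous for the norm topology. (b) Suppose that $-\infty<m<+\infty$ and that $u\in\mathcal C$ satisfies $\mathcal E(u)=m$. Then there is $\lambda\in\mathbb R$ such that, for every $\varphi$ in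 $$V_u=\{v\in W_0^{1,p}(\Omega)\cap L^\infty(\Omega): u\in L^\infty(\{x\in\Omega: v(x)\ne0\})\},$$ all the integrands below are in $L^1(\Omega)$ and $$\int_\Omega j_t(u,|Du|)\frac{Du}{|Du|}\cdot D\varphi+\int_\Omega j_s(u,|Du|)\varphi-\int_\Omega f(|x|,u)\varphi=\lambda\int_\Omega g(u)\varphi,$$ with the convention $j_t(u,|Du|)\frac{Du}{|Du|}=0$ where $Du=0$. -/

import Mathlib

open MeasureTheory Set Filter Topology
open scoped ENNReal ContDiff

/-- Euclidean space `ℝ^N` with its Euclidean norm. -/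
abbrev RN (N : ℕ) : Type := EuclideanSpace ℝ (Fin N)

instance fact_one_le_ofReal (p : ℝ) [hp : Fact (1 < p)] : Fact (1 ≤ ENNReal.ofReal p) :=
  ⟨by simpa using hp.out.le⟩

/-- `φ ∈ C_c^∞(Ω)`. -/
structure IsTestFunction {N : ℕ} (Ω : Set (RN N)) (φ : RN N → ℝ) : Prop where
  smooth : ContDiff ℝ ∞ φ
  compact : HasCompactSupport φ
  support : tsupport φ ⊆ Ω

/-- The subspace `{(φ, Dφ) : φ ∈ C_c^∞(Ω)}` of `L^p(Ω) × L^p(Ω; ℝ^N)`. -/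
def testPairs {N : ℕ} (p : ℝ) [Fact (1 < p)] (Ω : Set (RN N)) :
    Submodule ℝ (Lp ℝ (ENNReal.ofReal p) (volume.restrict Ω) ×
      Lp (RN N) (ENNReal.ofReal p) (volume.restrict Ω)) where
  carrier := {w | ∃ φ : RN N → ℝ, IsTestFunction Ω φ ∧
    w.1 =ᵐ[volume.restrict Ω] φ ∧ w.2 =ᵐ[volume.restrict Ω] gradient φ}
  zero_mem' := by
    refine ⟨0, ⟨contDiff_const, HasCompactSupport.zero, by simp [tsupport]⟩, ?_, ?_⟩
    · exact Lp.coeFn_zero ..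
    · filter_upwards [Lp.coeFn_zero (RN N) (ENNReal.ofReal p) (volume.restrict Ω)] with x hx
      have h : gradient (0 : RN N → ℝ) x = 0 := by simp [gradient]
      rw [h]
      exact hx
  add_mem' := by
    rintro a b ⟨φ, hφ, ha, ha'⟩ ⟨ψ, hψ, hb, hb'⟩
    refine ⟨φ + ψ, ⟨hφ.smooth.add hψ.smooth, hφ.compact.add hψ.compact,
      (tsupport_add φ ψ).trans (union_subset hφ.support hψ.support)⟩, ?_, ?_⟩
    · filter_upwards [Lp.coeFn_add a.1 b.1, ha, hb] with x h h1 h2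
      rw [Pi.add_apply, ← h1, ← h2]
      exact h
    · filter_upwards [Lp.coeFn_add a.2 b.2, ha', hb'] with x h h1 h2
      have d1 : DifferentiableAt ℝ φ x := hφ.smooth.differentiable (by simp) x
      have d2 : DifferentiableAt ℝ ψ x := hψ.smooth.differentiable (by simp) x
      have e : gradient (φ + ψ) x = gradient φ x + gradient ψ x := by
        simp [gradient, fderiv_add d1 d2]
      rw [e, ← h1, ← h2]
      exact h
  smul_mem' := by
    rintro c a ⟨φ, hφ, ha, ha'⟩
    refine ⟨c • φ, ⟨contDiff_const.smul hφ.smooth, hφ.compact.smul_left (f := fun _ => c),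
      (tsupport_smul_subset_right (fun _ => c) φ).trans hφ.support⟩, ?_, ?_⟩
    · filter_upwards [Lp.coeFn_smul c a.1, ha] with x h h1
      rw [Pi.smul_apply, ← h1]
      exact h
    · filter_upwards [Lp.coeFn_smul c a.2, ha'] with x h h1
      have d1 : DifferentiableAt ℝ φ x := hφ.smooth.differentiable (by simp) x
      have e : gradient (c • φ) x = c • gradient φ x := by
        simp [gradient, fderiv_const_smul d1]
      rw [e, ← h1]
      exact h

/-- The Sobolev space `W_0^{1,p}(Ω)`: the closure of `C_c^∞(Ω)` in the `W^{1,p}` norm. A function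
`u` is stored together with its weak gradient, as the pair `(u, Du)`, which is the limit in
`L^p(Ω) × L^p(Ω; ℝ^N)` of pairs `(φ_n, Dφ_n)` with `φ_n ∈ C_c^∞(Ω)`. The topology is the norm
topology of `L^p × L^p`, that is, the one of the `W^{1,p}` norm. -/
noncomputable abbrev W0 {N : ℕ} (p : ℝ) [Fact (1 < p)] (Ω : Set (RN N)) :
    Submodule ℝ (Lp ℝ (ENNReal.ofReal p) (volume.restrict Ω) ×
      Lp (RN N) (ENNReal.ofReal p) (volume.restrict Ω)) :=
  (testPairs p Ω).topologicalClosure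

section Sobolev

variable {N : ℕ} {p : ℝ} [Fact (1 < p)] {Ω : Set (RN N)}

/-- The (almost everywhere defined) values of `u ∈ W_0^{1,p}(Ω)`. -/
noncomputable def W0.val (u : W0 p Ω) : RN N → ℝ := u.1.1

/-- The weak gradient `Du` of `u ∈ W_0^{1,p}(Ω)`. -/
noncomputable def W0.grad (u : W0 p Ω) : RN N → RN N := u.1.2

end Sobolev

/-- The critical Sobolev exponent `p^* = Np/(N-p)`. -/
noncomputable def sobolevExp (N : ℕ) (p : ℝ) : ℝ := N * p / (N - p)

/-- The assumptions on `j : ℝ × [0,∞) → ℝ`, whose partial derivatives are `js` and `jt`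
(one-sided in `t` at `t = 0`): they exist and are continuous, and `j`, `js`, `jt` satisfy the
growth conditions. Only the values `j s t` with `t ≥ 0` are relevant. -/
structure AssumptionsJ (N : ℕ) (p : ℝ) (j js jt : ℝ → ℝ → ℝ) : Prop where
  hasDeriv_s : ∀ s, ∀ t ∈ Ici (0 : ℝ), HasDerivAt (fun σ => j σ t) (js s t) s
  hasDeriv_t : ∀ s, ∀ t ∈ Ici (0 : ℝ), HasDerivWithinAt (j s) (jt s t) (Ici 0) t
  continuous_s : ContinuousOn (fun z : ℝ × ℝ => js z.1 z.2) (univ ×ˢ Ici 0)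
  continuous_t : ContinuousOn (fun z : ℝ × ℝ => jt z.1 z.2) (univ ×ˢ Ici 0)
  growth : ∃ α₀ > 0, ∃ α : ℝ → ℝ,
    ContinuousOn α (Ici 0) ∧ MonotoneOn α (Ici 0) ∧ (∀ r ∈ Ici (0 : ℝ), 0 ≤ α r) ∧
    ∀ (s : ℝ) (ξ : RN N), α₀ * ‖ξ‖ ^ p ≤ j s ‖ξ‖ ∧ j s ‖ξ‖ ≤ α |s| * ‖ξ‖ ^ p
  growth_s : ∃ β : ℝ → ℝ,
    ContinuousOn β (Ici 0) ∧ MonotoneOn β (Ici 0) ∧ (∀ r ∈ Ici (0 : ℝ), 0 ≤ β r) ∧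
    ∀ (s : ℝ) (ξ : RN N), |js s ‖ξ‖| ≤ β |s| * ‖ξ‖ ^ p
  growth_t : ∃ γ : ℝ → ℝ,
    ContinuousOn γ (Ici 0) ∧ MonotoneOn γ (Ici 0) ∧ (∀ r ∈ Ici (0 : ℝ), 0 ≤ γ r) ∧
    ∀ (s : ℝ) (ξ : RN N), |jt s ‖ξ‖| ≤ γ |s| * ‖ξ‖ ^ (p - 1)

/-- The assumptions on `f`: `(x, s) ↦ f(|x|, s)` is a Carathéodory function on `Ω × ℝ` with
`|f(|x|, s)| ≤ a(|x|) + C |s|^{p^*-1}` for a radial `a ∈ L^{Np/(N(p-1)+p)}(Ω)`. -/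
structure AssumptionsF {N : ℕ} (p : ℝ) (Ω : Set (RN N)) (f : ℝ → ℝ → ℝ) : Prop where
  measurable : ∀ s, AEStronglyMeasurable (fun x : RN N => f ‖x‖ s) (volume.restrict Ω)
  continuous : ∀ᵐ x ∂(volume.restrict Ω), Continuous (f ‖x‖)
  growth : ∃ C > 0, ∃ a : ℝ → ℝ,
    MemLp (fun x : RN N => a ‖x‖) (ENNReal.ofReal (N * p / (N * (p - 1) + p)))
      (volume.restrict Ω) ∧
    ∀ᵐ x ∂(volume.restrict Ω), ∀ s : ℝ, |f ‖x‖ s| ≤ a ‖x‖ + C * |s| ^ (sobolevExp N p - 1)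

/-- The assumptions on `g`: continuity and `|g(s)| ≤ C |s|^{p-1} + C |s|^{p^*-1}`. -/
structure AssumptionsG (N : ℕ) (p : ℝ) (g : ℝ → ℝ) : Prop where
  continuous : Continuous g
  growth : ∃ C > 0, ∀ s : ℝ, |g s| ≤ C * |s| ^ (p - 1) + C * |s| ^ (sobolevExp N p - 1)

/-- `F(r, s)`, the primitive of `f(r, ·)` with `F(r, 0) = 0`. -/
noncomputable def primF (f : ℝ → ℝ → ℝ) (r s : ℝ) : ℝ := ∫ τ in (0 : ℝ)..s, f r τ

/-- `G(s)`, the primitive of `g` with `G(0) = 0`. -/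
noncomputable def primG (g : ℝ → ℝ) (s : ℝ) : ℝ := ∫ τ in (0 : ℝ)..s, g τ

section Problem

variable {N : ℕ} {p : ℝ} [Fact (1 < p)] {Ω : Set (RN N)}

/-- `J(u) = ∫_Ω j(u, |Du|) ∈ [0, +∞]`, for a nonnegative integrand `j`. -/
noncomputable def funcJ (j : ℝ → ℝ → ℝ) (u : W0 p Ω) : ℝ≥0∞ :=
  ∫⁻ x in Ω, ENNReal.ofReal (j (W0.val u x) ‖W0.grad u x‖)

/-- `ℰ(u) = ∫_Ω j(u, |Du|) - ∫_Ω F(|x|, u) ∈ ℝ ∪ {+∞}`. -/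
noncomputable def funcE (j f : ℝ → ℝ → ℝ) (u : W0 p Ω) : EReal :=
  (funcJ j u : EReal) - ((∫ x in Ω, primF f ‖x‖ (W0.val u x) : ℝ) : EReal)

/-- The constraint `𝒞 = {u ∈ W_0^{1,p}(Ω) : ∫_Ω G(u) = 1}`. -/
def constraintC (p : ℝ) [Fact (1 < p)] (Ω : Set (RN N)) (g : ℝ → ℝ) : Set (W0 p Ω) :=
  {u | ∫ x in Ω, primG g (W0.val u x) = 1}

open Classical in
/-- `ℰ*`, equal to `ℰ` on `𝒞` and to `+∞` off `𝒞`. -/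
noncomputable def funcEStar (j f : ℝ → ℝ → ℝ) (g : ℝ → ℝ) (u : W0 p Ω) : EReal :=
  if u ∈ constraintC p Ω g then funcE j f u else ⊤

/-- `m = inf_{v ∈ 𝒞} ℰ(v)`. -/
noncomputable def infValue (p : ℝ) [Fact (1 < p)] (Ω : Set (RN N))
    (j f : ℝ → ℝ → ℝ) (g : ℝ → ℝ) : EReal :=
  ⨅ v ∈ constraintC p Ω g, funcE j f v

/-- `u` solves the minimization problem `m = inf_{v ∈ 𝒞} ℰ(v)`, `-∞ < m < +∞`. -/
structure IsSolution (j f : ℝ → ℝ → ℝ) (g : ℝ → ℝ) (u : W0 p Ω) : Prop where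
  bot_lt : ⊥ < infValue p Ω j f g
  lt_top : infValue p Ω j f g < ⊤
  mem : u ∈ constraintC p Ω g
  eq : funcE j f u = infValue p Ω j f g

/-- `V_u = {v ∈ W_0^{1,p}(Ω) ∩ L^∞(Ω) : u ∈ L^∞({v ≠ 0})}`. -/
def testSpaceV (u : W0 p Ω) : Set (W0 p Ω) :=
  {v | (∃ M : ℝ, ∀ᵐ x ∂(volume.restrict Ω), |W0.val v x| ≤ M) ∧
    ∃ M : ℝ, ∀ᵐ x ∂(volume.restrict Ω), W0.val v x ≠ 0 → |W0.val u x| ≤ M}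

/-- The integrand `j_t(u, |Du|) (Du/|Du|) · Dφ`, with the convention that
`j_t(u, |Du|) Du/|Du| = 0` where `Du = 0`. -/
noncomputable def fluxTerm (jt : ℝ → ℝ → ℝ) (u φ : W0 p Ω) (x : RN N) : ℝ :=
  jt (W0.val u x) ‖W0.grad u x‖ * inner ℝ (‖W0.grad u x‖⁻¹ • W0.grad u x) (W0.grad φ x)

end Problem

/-!
The theorem rests on three groups of facts.

Lower order terms. By the Sobolev inequality (`W0.exists_eLpNorm_val_le`), `W_0^{1,p}(Ω)` embeds
continuously in `L^p ∩ L^{p^*}`. Both `f(|x|, s)` and `g(s)` are Carathéodory integrands whose growth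
is dual to `L^p ∩ L^{p^*}` (`NemytskiiGrowth`), so by Hölder's inequality the integrals of their
primitives are finite, continuous (`NemytskiiGrowth.tendsto_integral_primitive`) and differentiable
in finitely many directions (`NemytskiiGrowth.hasFDerivAt_integral_primitive`). Hence the constraint
is closed, and as `J` is lower semicontinuous by Fatou's lemma, so is the constrained functional.

The principal term. `J` may be infinite and is not differentiable in general, but it is
differentiable at a point of finite energy along `V_u`. If `φ ∈ V_u`, then `u` is bounded where
`φ ≠ 0`, which yields an integrable majorant of the derivative there; where `φ = 0`, also `Dφ = 0`
almost everywhere (`W0.grad_eq_zero_of_val_eq_zero`), and the integrand does not vary. The integrand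
`(s, ξ) ↦ j(s, |ξ|)` itself is `C¹` because `j_t(s, 0) = 0` (`AssumptionsJ.hasFDerivAt`).

The multiplier. The constraint is not degenerate along `V_u`
(`exists_mem_testSpaceV_integral_ne_zero`): if it were, then `g(u) = 0` almost everywhere, and the
chain rule together with the Sobolev inequality would give `G(u) = 0`, against `∫ G(u) = 1`. So
there is `ψ ∈ V_u` with `∫ g(u) ψ ≠ 0`, and for each `φ ∈ V_u` a Lagrange multiplier rule for
functions of two variables (`mul_eq_mul_of_eventually_le_of_hasFDerivAt`), applied in the plane
`u + span {φ, ψ}`, identifies the multiplier as the quotient of the derivatives along `ψ`, which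
does not depend on `φ`.
-/

/-! ### Integrands of Carathéodory type -/

section Nemytskii

variable {X : Type*} [MeasurableSpace X] {μ : Measure X}

/-- A Carathéodory function agrees, off a null set of `x`, with a jointly measurable function. -/
theorem exists_stronglyMeasurable_uncurry_of_caratheodory {h : X → ℝ → ℝ}
    (hm : ∀ s, AEStronglyMeasurable (fun x => h x s) μ) (hc : ∀ᵐ x ∂μ, Continuous (h x)) :
    ∃ k : X → ℝ → ℝ, StronglyMeasurable (Function.uncurry k) ∧ ∀ᵐ x ∂μ, h x = k x := by
  classical
  set A : Set X := {x | Continuous (h x) ∧ ∀ q : ℚ, h x q = (hm q).mk _ x} with hA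
  have hAe : ∀ᵐ x ∂μ, x ∈ A := by
    have h2 : ∀ᵐ x ∂μ, ∀ q : ℚ, h x q = (hm q).mk _ x := ae_all_iff.2 fun q => (hm q).ae_eq_mk
    filter_upwards [hc, h2] with x h1 h2 using ⟨h1, h2⟩
  set T : Set X := (toMeasurable μ Aᶜ)ᶜ with hT
  have hTm : MeasurableSet T := (measurableSet_toMeasurable μ Aᶜ).compl
  have hTA : T ⊆ A := by
    rw [hT, compl_subset_comm]
    exact subset_toMeasurable μ Aᶜ
  have hTe : ∀ᵐ x ∂μ, x ∈ T := by
    rw [ae_iff]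
    have : {x | x ∉ T} = toMeasurable μ Aᶜ := by ext x; simp [hT]
    rw [this, measure_toMeasurable]
    exact ae_iff.1 hAe
  let k : X → ℝ → ℝ := fun x s => T.indicator (fun x => h x s) x
  have kc : ∀ x, Continuous (k x) := by
    intro x
    by_cases hx : x ∈ T
    · simpa [k, hx] using (hTA hx).1
    · simpa [k, hx] using continuous_const
  have kq : ∀ q : ℚ, StronglyMeasurable (fun x => k x q) := by
    intro q
    have : (fun x => k x q) = T.indicator ((hm q).mk _) := by
      ext x
      by_cases hx : x ∈ T
      · simp [k, hx, (hTA hx).2 q]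
      · simp [k, hx]
    rw [this]
    exact (hm q).stronglyMeasurable_mk.indicator hTm
  have km : ∀ s, StronglyMeasurable (fun x => k x s) := by
    intro s
    obtain ⟨q, hq, hqs⟩ := mem_closure_iff_seq_limit.1 (Rat.denseRange_cast (𝕜 := ℝ) s)
    choose r hr using hq
    refine stronglyMeasurable_of_tendsto atTop (fun n => kq (r n)) ?_
    rw [tendsto_pi_nhds]
    intro x
    have := ((kc x).tendsto s).comp hqs
    simpa [Function.comp_def, hr] using this
  refine ⟨k, ?_, ?_⟩
  · have := stronglyMeasurable_uncurry_of_continuous_of_stronglyMeasurable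
      (u := fun s x => k x s) kc km
    exact this.comp_measurable measurable_swap
  · filter_upwards [hTe] with x hx
    ext s
    simp [k, hx]

theorem aestronglyMeasurable_caratheodory_comp {h : X → ℝ → ℝ}
    (hm : ∀ s, AEStronglyMeasurable (fun x => h x s) μ) (hc : ∀ᵐ x ∂μ, Continuous (h x))
    {w : X → ℝ} (hw : AEStronglyMeasurable w μ) :
    AEStronglyMeasurable (fun x => h x (w x)) μ := by
  obtain ⟨k, hk, hhk⟩ := exists_stronglyMeasurable_uncurry_of_caratheodory hm hc
  refine ⟨fun x => k x (hw.mk w x), ?_, ?_⟩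
  · exact hk.comp_measurable (measurable_id.prodMk hw.stronglyMeasurable_mk.measurable)
  · filter_upwards [hhk, hw.ae_eq_mk] with x h1 h2
    rw [h1, h2]

theorem aestronglyMeasurable_caratheodory_primitive {h : X → ℝ → ℝ}
    (hm : ∀ s, AEStronglyMeasurable (fun x => h x s) μ) (hc : ∀ᵐ x ∂μ, Continuous (h x))
    {w : X → ℝ} (hw : AEStronglyMeasurable w μ) :
    AEStronglyMeasurable (fun x => ∫ τ in (0 : ℝ)..w x, h x τ) μ := by
  refine aestronglyMeasurable_caratheodory_comp
    (h := fun x s => ∫ τ in (0 : ℝ)..s, h x τ) ?_ ?_ hw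
  · intro s
    obtain ⟨k, hk, hhk⟩ := exists_stronglyMeasurable_uncurry_of_caratheodory hm hc
    refine ⟨fun x => ∫ τ in (0 : ℝ)..s, k x τ, ?_, ?_⟩
    · simp only [intervalIntegral]
      exact hk.integral_prod_right.sub hk.integral_prod_right
    · filter_upwards [hhk] with x h1
      rw [h1]
  · filter_upwards [hc] with x hx
    exact intervalIntegral.continuous_primitive (fun a b => hx.intervalIntegrable a b) 0

/-- A Carathéodory integrand `h` whose growth is that of a function in the dual of `L^p ∩ L^r`
evaluated along `L^p ∩ L^r`. It covers both `f(|x|, s)` and `g(s)`. -/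
structure NemytskiiGrowth (p r : ℝ) (μ : Measure X) (h : X → ℝ → ℝ) : Prop where
  measurable : ∀ s, AEStronglyMeasurable (fun x => h x s) μ
  continuous : ∀ᵐ x ∂μ, Continuous (h x)
  growth : ∃ C ≥ 0, ∃ A : X → ℝ, MemLp A (ENNReal.ofReal (r / (r - 1))) μ ∧
    ∀ᵐ x ∂μ, ∀ s : ℝ, |h x s| ≤ A x + C * (|s| ^ (p - 1) + |s| ^ (r - 1))

theorem holderConjugate_ofReal {r : ℝ} (hr : 1 < r) :
    ENNReal.HolderConjugate (ENNReal.ofReal (r / (r - 1))) (ENNReal.ofReal r) := by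
  have h : r.HolderConjugate (r / (r - 1)) := Real.HolderConjugate.conjExponent hr
  exact h.symm.ennrealOfReal

theorem eLpNorm_abs_rpow_sub_one {r : ℝ} (hr : 1 < r) (W : X → ℝ) :
    eLpNorm (fun x => |W x| ^ (r - 1)) (ENNReal.ofReal (r / (r - 1))) μ
      = eLpNorm W (ENNReal.ofReal r) μ ^ (r - 1) := by
  have h1 : 0 < r - 1 := by linarith
  have := eLpNorm_norm_rpow (μ := μ) (p := ENNReal.ofReal (r / (r - 1))) W h1
  rw [← ENNReal.ofReal_mul (by positivity), div_mul_cancel₀ _ h1.ne'] at this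
  simpa using this

theorem MemLp.abs_rpow_sub_one {r : ℝ} (hr : 1 < r) {W : X → ℝ}
    (hW : MemLp W (ENNReal.ofReal r) μ) :
    MemLp (fun x => |W x| ^ (r - 1)) (ENNReal.ofReal (r / (r - 1))) μ := by
  refine ⟨?_, ?_⟩
  · exact (hW.1.norm.aemeasurable.pow_const (r - 1)).aestronglyMeasurable
  · rw [eLpNorm_abs_rpow_sub_one hr]
    exact ENNReal.rpow_lt_top_of_nonneg (by linarith) hW.2.ne

theorem lintegral_enorm_mul_le {q : ℝ} (hq : 1 < q) {B D : X → ℝ} (hB : AEStronglyMeasurable B μ)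
    (hD : AEStronglyMeasurable D μ) : ∫⁻ x, ‖B x * D x‖ₑ ∂μ
      ≤ eLpNorm B (ENNReal.ofReal (q / (q - 1))) μ * eLpNorm D (ENNReal.ofReal q) μ := by
  have := holderConjugate_ofReal hq
  have h := eLpNorm_smul_le_mul_eLpNorm (μ := μ) (p := ENNReal.ofReal (q / (q - 1)))
    (q := ENNReal.ofReal q) (r := 1) hD hB
  rw [eLpNorm_one_eq_lintegral_enorm] at h
  exact h

theorem eventually_eLpNorm_add_abs_le {q : ℝ} (hq : 1 < q) {ι : Type*} {l : Filter ι}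
    {w : ι → X → ℝ} {u : X → ℝ} (hw : ∀ n, MemLp (w n) (ENNReal.ofReal q) μ)
    (hu : MemLp u (ENNReal.ofReal q) μ)
    (ht : Tendsto (fun n => eLpNorm (w n - u) (ENNReal.ofReal q) μ) l (𝓝 0)) :
    ∀ᶠ n in l, eLpNorm (fun x => |w n x| + |u x|) (ENNReal.ofReal q) μ
      ≤ 1 + 2 * eLpNorm u (ENNReal.ofReal q) μ := by
  have h1 : (1 : ℝ≥0∞) ≤ ENNReal.ofReal q := by simpa using hq.le
  filter_upwards [ht.eventually (gt_mem_nhds (zero_lt_one' ℝ≥0∞))] with n hn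
  have e1 : eLpNorm (fun x => |w n x| + |u x|) (ENNReal.ofReal q) μ
      ≤ eLpNorm (w n) (ENNReal.ofReal q) μ + eLpNorm u (ENNReal.ofReal q) μ := by
    have := eLpNorm_add_le (μ := μ) (p := ENNReal.ofReal q) (hw n).1.norm hu.1.norm h1
    simp only [eLpNorm_norm] at this
    exact this
  have e2 : eLpNorm (w n) (ENNReal.ofReal q) μ
      ≤ eLpNorm (w n - u) (ENNReal.ofReal q) μ + eLpNorm u (ENNReal.ofReal q) μ := by
    have := eLpNorm_add_le (μ := μ) (p := ENNReal.ofReal q) ((hw n).1.sub hu.1) hu.1 h1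
    simpa using this
  calc _ ≤ _ := e1
    _ ≤ (1 + eLpNorm u (ENNReal.ofReal q) μ) + eLpNorm u (ENNReal.ofReal q) μ := by
      gcongr
      exact e2.trans (by gcongr)
    _ = _ := by rw [two_mul, add_assoc]

theorem integrable_majorant {p r C : ℝ} (hp : 1 < p) (hr : 1 < r) {A W V : X → ℝ}
    (hA : MemLp A (ENNReal.ofReal (r / (r - 1))) μ)
    (hWp : MemLp W (ENNReal.ofReal p) μ) (hWr : MemLp W (ENNReal.ofReal r) μ)
    (hVp : MemLp V (ENNReal.ofReal p) μ) (hVr : MemLp V (ENNReal.ofReal r) μ) :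
    Integrable (fun x => (A x + C * (|W x| ^ (p - 1) + |W x| ^ (r - 1))) * V x) μ := by
  have := holderConjugate_ofReal hp
  have := holderConjugate_ofReal hr
  have h1 : Integrable (fun x => A x * V x) μ := hA.integrable_mul hVr
  have h2 : Integrable (fun x => |W x| ^ (p - 1) * V x) μ :=
    (MemLp.abs_rpow_sub_one hp hWp).integrable_mul hVp
  have h3 : Integrable (fun x => |W x| ^ (r - 1) * V x) μ :=
    (MemLp.abs_rpow_sub_one hr hWr).integrable_mul hVr
  refine (h1.add ((h2.add h3).const_mul C)).congr (Eventually.of_forall fun x => ?_)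
  simp only [Pi.add_apply]
  ring

/-- The estimate on a primitive which follows from the growth of its integrand. -/
theorem abs_primitive_sub_le {k : ℝ → ℝ} (hk : Continuous k) {p r A C : ℝ} (hp : 1 < p)
    (hr : 1 < r) (hC : 0 ≤ C) (hb : ∀ s, |k s| ≤ A + C * (|s| ^ (p - 1) + |s| ^ (r - 1)))
    {a b W : ℝ} (ha : |a| ≤ W) (hb' : |b| ≤ W) :
    |(∫ τ in (0 : ℝ)..a, k τ) - ∫ τ in (0 : ℝ)..b, k τ|
      ≤ (A + C * (|W| ^ (p - 1) + |W| ^ (r - 1))) * |a - b| := by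
  have hW : 0 ≤ W := (abs_nonneg a).trans ha
  rw [intervalIntegral.integral_interval_sub_left (hk.intervalIntegrable _ _)
    (hk.intervalIntegrable _ _), ← Real.norm_eq_abs]
  refine intervalIntegral.norm_integral_le_of_norm_le_const fun x hx => ?_
  have hx' : |x| ≤ W := by
    have h1 := abs_le.1 ha
    have h2 := abs_le.1 hb'
    rcases mem_uIoc.1 hx with h | h <;> exact abs_le.2 ⟨by linarith, by linarith⟩
  refine (hb x).trans ?_
  rw [abs_of_nonneg hW]
  have : 0 ≤ p - 1 := by linarith
  have : 0 ≤ r - 1 := by linarith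
  gcongr

namespace NemytskiiGrowth

variable {p r : ℝ} {h : X → ℝ → ℝ}

theorem integrable_mul (H : NemytskiiGrowth p r μ h) (hp : 1 < p) (hr : 1 < r) {u v : X → ℝ}
    (hup : MemLp u (ENNReal.ofReal p) μ) (hur : MemLp u (ENNReal.ofReal r) μ)
    (hvp : MemLp v (ENNReal.ofReal p) μ) (hvr : MemLp v (ENNReal.ofReal r) μ) :
    Integrable (fun x => h x (u x) * v x) μ := by
  obtain ⟨C, hC, A, hA, hg⟩ := H.growth
  refine (integrable_majorant (C := C) hp hr hA hup hur hvp.norm hvr.norm).mono'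
    ((aestronglyMeasurable_caratheodory_comp H.measurable H.continuous hup.1).mul hvp.1) ?_
  filter_upwards [hg] with x hx
  rw [norm_mul, Real.norm_eq_abs]
  exact mul_le_mul_of_nonneg_right (hx _) (norm_nonneg _)

theorem integrable_primitive (H : NemytskiiGrowth p r μ h) (hp : 1 < p) (hr : 1 < r) {u : X → ℝ}
    (hup : MemLp u (ENNReal.ofReal p) μ) (hur : MemLp u (ENNReal.ofReal r) μ) :
    Integrable (fun x => ∫ τ in (0 : ℝ)..u x, h x τ) μ := by
  obtain ⟨C, hC, A, hA, hg⟩ := H.growth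
  refine (integrable_majorant (C := C) hp hr hA hup hur hup.norm hur.norm).mono'
    (aestronglyMeasurable_caratheodory_primitive H.measurable H.continuous hup.1) ?_
  filter_upwards [hg, H.continuous] with x hx hc
  have := abs_primitive_sub_le hc hp hr hC hx (a := u x) (b := 0) (W := |u x|) le_rfl (by simp)
  simpa using this

/-- The integral functional of the primitive is continuous on `L^p ∩ L^r`: by Hölder's inequality
it is even locally Lipschitz. -/
theorem tendsto_integral_primitive (H : NemytskiiGrowth p r μ h) (hp : 1 < p) (hr : 1 < r)
    {ι : Type*} {l : Filter ι} {w : ι → X → ℝ} {u : X → ℝ}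
    (hwp : ∀ n, MemLp (w n) (ENNReal.ofReal p) μ) (hwr : ∀ n, MemLp (w n) (ENNReal.ofReal r) μ)
    (hup : MemLp u (ENNReal.ofReal p) μ) (hur : MemLp u (ENNReal.ofReal r) μ)
    (tp : Tendsto (fun n => eLpNorm (w n - u) (ENNReal.ofReal p) μ) l (𝓝 0))
    (tr : Tendsto (fun n => eLpNorm (w n - u) (ENNReal.ofReal r) μ) l (𝓝 0)) :
    Tendsto (fun n => ∫ x, (∫ τ in (0 : ℝ)..w n x, h x τ) ∂μ) l
      (𝓝 (∫ x, (∫ τ in (0 : ℝ)..u x, h x τ) ∂μ)) := by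
  obtain ⟨C, hC, A, hA, hg⟩ := H.growth
  have hp0 : 0 ≤ p - 1 := by linarith
  have hr0 : 0 ≤ r - 1 := by linarith
  refine tendsto_integral_of_L1 _ (H.integrable_primitive hp hr hup hur).1
    (Eventually.of_forall fun n => H.integrable_primitive hp hr (hwp n) (hwr n)) ?_
  set W : ι → X → ℝ := fun n x => |w n x| + |u x| with hW
  have hWp : ∀ n, MemLp (W n) (ENNReal.ofReal p) μ := fun n => (hwp n).norm.add hup.norm
  have hWr : ∀ n, MemLp (W n) (ENNReal.ofReal r) μ := fun n => (hwr n).norm.add hur.norm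
  set Kp : ℝ≥0∞ := (1 + 2 * eLpNorm u (ENNReal.ofReal p) μ) ^ (p - 1) with hKp
  set Kr : ℝ≥0∞ := (1 + 2 * eLpNorm u (ENNReal.ofReal r) μ) ^ (r - 1) with hKr
  have Kpt : Kp ≠ ⊤ := ENNReal.rpow_ne_top_of_nonneg hp0
    (ENNReal.add_ne_top.2 ⟨by simp, ENNReal.mul_ne_top (by simp) hup.2.ne⟩)
  have Krt : Kr ≠ ⊤ := ENNReal.rpow_ne_top_of_nonneg hr0
    (ENNReal.add_ne_top.2 ⟨by simp, ENNReal.mul_ne_top (by simp) hur.2.ne⟩)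
  have main : ∀ᶠ n in l, ∫⁻ x, ‖(∫ τ in (0 : ℝ)..w n x, h x τ) - ∫ τ in (0 : ℝ)..u x, h x τ‖ₑ ∂μ
      ≤ eLpNorm A (ENNReal.ofReal (r / (r - 1))) μ * eLpNorm (w n - u) (ENNReal.ofReal r) μ
        + ENNReal.ofReal C * (Kp * eLpNorm (w n - u) (ENNReal.ofReal p) μ
          + Kr * eLpNorm (w n - u) (ENNReal.ofReal r) μ) := by
    filter_upwards [eventually_eLpNorm_add_abs_le hp hwp hup tp,
      eventually_eLpNorm_add_abs_le hr hwr hur tr] with n b1 b2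
    have mP := (MemLp.abs_rpow_sub_one hp (hWp n)).1
    have mR := (MemLp.abs_rpow_sub_one hr (hWr n)).1
    have mD : AEStronglyMeasurable (w n - u) μ := (hwp n).1.sub hup.1
    calc ∫⁻ x, ‖(∫ τ in (0 : ℝ)..w n x, h x τ) - ∫ τ in (0 : ℝ)..u x, h x τ‖ₑ ∂μ
        ≤ ∫⁻ x, ‖A x * (w n - u) x‖ₑ + ENNReal.ofReal C * (‖|W n x| ^ (p - 1) * (w n - u) x‖ₑ
            + ‖|W n x| ^ (r - 1) * (w n - u) x‖ₑ) ∂μ := by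
          refine lintegral_mono_ae ?_
          filter_upwards [hg, H.continuous] with x hx hc
          have e := abs_primitive_sub_le hc hp hr hC hx (a := w n x) (b := u x) (W := W n x)
            (by simp [hW]) (by simp [hW])
          have e' : |(∫ τ in (0 : ℝ)..w n x, h x τ) - ∫ τ in (0 : ℝ)..u x, h x τ|
              ≤ |A x * (w n - u) x| + C * (|(|W n x| ^ (p - 1) * (w n - u) x)|
                + |(|W n x| ^ (r - 1) * (w n - u) x)|) := by
            refine e.trans ?_
            rw [abs_mul, abs_mul, abs_mul, abs_of_nonneg (a := |W n x| ^ (p - 1)) (by positivity),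
              abs_of_nonneg (a := |W n x| ^ (r - 1)) (by positivity), Pi.sub_apply]
            nlinarith [mul_le_mul_of_nonneg_right (le_abs_self (A x)) (abs_nonneg (w n x - u x))]
          simp only [Real.enorm_eq_ofReal_abs]
          rw [← ENNReal.ofReal_add (by positivity) (by positivity), ← ENNReal.ofReal_mul hC,
            ← ENNReal.ofReal_add (by positivity) (by positivity)]
          exact ENNReal.ofReal_le_ofReal e'
      _ = ∫⁻ x, ‖A x * (w n - u) x‖ₑ ∂μ + ENNReal.ofReal C *
            (∫⁻ x, ‖|W n x| ^ (p - 1) * (w n - u) x‖ₑ ∂μ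
              + ∫⁻ x, ‖|W n x| ^ (r - 1) * (w n - u) x‖ₑ ∂μ) := by
          have m1 : AEMeasurable (fun x => ‖A x * (w n - u) x‖ₑ) μ := (hA.1.mul mD).enorm
          have m2 : AEMeasurable (fun x => ‖|W n x| ^ (p - 1) * (w n - u) x‖ₑ) μ :=
            (mP.mul mD).enorm
          rw [lintegral_add_left' m1, lintegral_const_mul' _ _ (by simp), lintegral_add_left' m2]
      _ ≤ _ := by
          gcongr
          · exact lintegral_enorm_mul_le hr hA.1 mD
          · refine (lintegral_enorm_mul_le hp mP mD).trans ?_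
            rw [eLpNorm_abs_rpow_sub_one hp]
            gcongr
            exact ENNReal.rpow_le_rpow b1 hp0
          · refine (lintegral_enorm_mul_le hr mR mD).trans ?_
            rw [eLpNorm_abs_rpow_sub_one hr]
            gcongr
            exact ENNReal.rpow_le_rpow b2 hr0
  have lim : Tendsto (fun n => eLpNorm A (ENNReal.ofReal (r / (r - 1))) μ
        * eLpNorm (w n - u) (ENNReal.ofReal r) μ
        + ENNReal.ofReal C * (Kp * eLpNorm (w n - u) (ENNReal.ofReal p) μ
          + Kr * eLpNorm (w n - u) (ENNReal.ofReal r) μ)) l (𝓝 0) := by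
    have t1 := ENNReal.Tendsto.const_mul (a := eLpNorm A (ENNReal.ofReal (r / (r - 1))) μ) tr
      (Or.inr hA.2.ne)
    have t2 := ENNReal.Tendsto.const_mul (a := Kp) tp (Or.inr Kpt)
    have t3 := ENNReal.Tendsto.const_mul (a := Kr) tr (Or.inr Krt)
    have t4 := ENNReal.Tendsto.const_mul (a := ENNReal.ofReal C) (t2.add t3)
      (Or.inr ENNReal.ofReal_ne_top)
    simpa using t1.add t4
  exact tendsto_of_tendsto_of_tendsto_of_le_of_le' tendsto_const_nhds lim
    (Eventually.of_forall fun _ => bot_le) main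

end NemytskiiGrowth

/-! ### Differentiation under the integral sign in a plane -/

/-- Differentiation under the integral sign at `0` for integrands composed with a map which is
affine in two real parameters. -/
theorem hasFDerivAt_integral_comp_plane {V : Type*} [NormedAddCommGroup V] [NormedSpace ℝ V]
    {H : X → V → ℝ} {H' : X → V → V →L[ℝ] ℝ} {a b c : X → V} {bound : X → ℝ}
    (hmeas : ∀ z : ℝ × ℝ, AEStronglyMeasurable (fun x => H x (a x + z.1 • b x + z.2 • c x)) μ)
    (hint : Integrable (fun x => H x (a x)) μ)
    (hb : AEStronglyMeasurable (fun x => H' x (a x) (b x)) μ)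
    (hc : AEStronglyMeasurable (fun x => H' x (a x) (c x)) μ)
    (hd : ∀ᵐ x ∂μ, ∀ v, HasFDerivAt (H x) (H' x v) v)
    (hbd : ∀ᵐ x ∂μ, ∀ z ∈ Metric.ball (0 : ℝ × ℝ) 1,
      |H' x (a x + z.1 • b x + z.2 • c x) (b x)|
        + |H' x (a x + z.1 • b x + z.2 • c x) (c x)| ≤ bound x)
    (hbi : Integrable bound μ) :
    Integrable (fun x => H' x (a x) (b x)) μ ∧ Integrable (fun x => H' x (a x) (c x)) μ ∧
    HasFDerivAt (fun z : ℝ × ℝ => ∫ x, H x (a x + z.1 • b x + z.2 • c x) ∂μ)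
      ((∫ x, H' x (a x) (b x) ∂μ) • ContinuousLinearMap.fst ℝ ℝ ℝ
        + (∫ x, H' x (a x) (c x) ∂μ) • ContinuousLinearMap.snd ℝ ℝ ℝ) 0 := by
  have hbd0 : ∀ᵐ x ∂μ, |H' x (a x) (b x)| + |H' x (a x) (c x)| ≤ bound x := by
    filter_upwards [hbd] with x hx
    simpa using hx 0 (by simp)
  have ib : Integrable (fun x => H' x (a x) (b x)) μ := hbi.mono' hb <| by
    filter_upwards [hbd0] with x hx
    rw [Real.norm_eq_abs]
    linarith [abs_nonneg (H' x (a x) (c x))]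
  have ic : Integrable (fun x => H' x (a x) (c x)) μ := hbi.mono' hc <| by
    filter_upwards [hbd0] with x hx
    rw [Real.norm_eq_abs]
    linarith [abs_nonneg (H' x (a x) (b x))]
  refine ⟨ib, ic, ?_⟩
  let D : ℝ × ℝ → X → (ℝ × ℝ) →L[ℝ] ℝ := fun z x =>
    (H' x (a x + z.1 • b x + z.2 • c x) (b x)) • ContinuousLinearMap.fst ℝ ℝ ℝ
      + (H' x (a x + z.1 • b x + z.2 • c x) (c x)) • ContinuousLinearMap.snd ℝ ℝ ℝ
  have D0 : D 0 = fun x => (H' x (a x) (b x)) • ContinuousLinearMap.fst ℝ ℝ ℝ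
      + (H' x (a x) (c x)) • ContinuousLinearMap.snd ℝ ℝ ℝ := by
    ext x <;> simp [D]
  have e : ∫ x, D 0 x ∂μ = (∫ x, H' x (a x) (b x) ∂μ) • ContinuousLinearMap.fst ℝ ℝ ℝ
        + (∫ x, H' x (a x) (c x) ∂μ) • ContinuousLinearMap.snd ℝ ℝ ℝ := by
    rw [D0, integral_add (ib.smul_const _) (ic.smul_const _), integral_smul_const,
      integral_smul_const]
  rw [← e]
  refine hasFDerivAt_integral_of_dominated_of_fderiv_le (bound := bound)
    (Metric.ball_mem_nhds (0 : ℝ × ℝ) one_pos) (Eventually.of_forall hmeas) (by simpa using hint)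
    ?_ ?_ hbi ?_
  · rw [D0]
    exact (hb.smul_const _).add (hc.smul_const _)
  · filter_upwards [hbd] with x hx z hz
    refine le_trans ?_ (hx z hz)
    refine (norm_add_le _ _).trans (add_le_add ?_ ?_)
    · rw [norm_smul, Real.norm_eq_abs]
      exact mul_le_of_le_one_right (abs_nonneg _) (ContinuousLinearMap.norm_fst_le ..)
    · rw [norm_smul, Real.norm_eq_abs]
      exact mul_le_of_le_one_right (abs_nonneg _) (ContinuousLinearMap.norm_snd_le ..)
  · filter_upwards [hd] with x hx z _
    have h1 : HasFDerivAt (fun z : ℝ × ℝ => a x + z.1 • b x + z.2 • c x)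
        ((ContinuousLinearMap.fst ℝ ℝ ℝ).smulRight (b x)
          + (ContinuousLinearMap.snd ℝ ℝ ℝ).smulRight (c x)) z :=
      ((hasFDerivAt_fst.smul_const (b x)).const_add (a x)).add (hasFDerivAt_snd.smul_const (c x))
    have h2 := (hx (a x + z.1 • b x + z.2 • c x)).comp z h1
    refine h2.congr_fderiv ?_
    ext <;> simp [D]

namespace NemytskiiGrowth

variable {p r : ℝ} {h : X → ℝ → ℝ}

theorem hasFDerivAt_integral_primitive (H : NemytskiiGrowth p r μ h) (hp : 1 < p) (hr : 1 < r)
    {u v w : X → ℝ}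
    (hup : MemLp u (ENNReal.ofReal p) μ) (hur : MemLp u (ENNReal.ofReal r) μ)
    (hvp : MemLp v (ENNReal.ofReal p) μ) (hvr : MemLp v (ENNReal.ofReal r) μ)
    (hwp : MemLp w (ENNReal.ofReal p) μ) (hwr : MemLp w (ENNReal.ofReal r) μ) :
    HasFDerivAt (fun z : ℝ × ℝ => ∫ x, (∫ τ in (0 : ℝ)..u x + z.1 • v x + z.2 • w x, h x τ) ∂μ)
      ((∫ x, h x (u x) * v x ∂μ) • ContinuousLinearMap.fst ℝ ℝ ℝ
        + (∫ x, h x (u x) * w x ∂μ) • ContinuousLinearMap.snd ℝ ℝ ℝ) 0 := by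
  obtain ⟨C, hC, A, hA, hg⟩ := H.growth
  have hp0 : 0 ≤ p - 1 := by linarith
  have hr0 : 0 ≤ r - 1 := by linarith
  have hh : AEStronglyMeasurable (fun x => h x (u x)) μ :=
    aestronglyMeasurable_caratheodory_comp H.measurable H.continuous hup.1
  have := hasFDerivAt_integral_comp_plane (μ := μ)
    (H := fun x s => ∫ τ in (0 : ℝ)..s, h x τ)
    (H' := fun x s => (h x s) • ContinuousLinearMap.id ℝ ℝ) (a := u) (b := v) (c := w)
    (bound := fun x => (A x + C * (|(|u x| + |v x| + |w x|)| ^ (p - 1)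
      + |(|u x| + |v x| + |w x|)| ^ (r - 1))) * (|v x| + |w x|))
    (fun z => aestronglyMeasurable_caratheodory_primitive H.measurable H.continuous
      ((hup.1.add (hvp.1.const_smul z.1)).add (hwp.1.const_smul z.2)))
    (H.integrable_primitive hp hr hup hur)
    (by simpa using! hh.mul hvp.1) (by simpa using! hh.mul hwp.1)
    ?_ ?_ (integrable_majorant (C := C) hp hr hA ((hup.norm.add hvp.norm).add hwp.norm)
      ((hur.norm.add hvr.norm).add hwr.norm) (hvp.norm.add hwp.norm) (hvr.norm.add hwr.norm))
  · simpa using this.2.2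
  · filter_upwards [H.continuous] with x hx s
    have := (intervalIntegral.integral_hasDerivAt_right (hx.intervalIntegrable 0 s)
      (hx.stronglyMeasurableAtFilter _ _) hx.continuousAt).hasFDerivAt
    refine this.congr_fderiv ?_
    ext
    simp
  · filter_upwards [hg] with x hx z hz
    have hz1 : |z.1| ≤ 1 := (norm_fst_le z).trans (mem_ball_zero_iff.1 hz).le
    have hz2 : |z.2| ≤ 1 := (norm_snd_le z).trans (mem_ball_zero_iff.1 hz).le
    have hW : |u x + z.1 • v x + z.2 • w x| ≤ |(|u x| + |v x| + |w x|)| := by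
      rw [abs_of_nonneg (a := |u x| + |v x| + |w x|) (by positivity)]
      refine (abs_add_three _ _ _).trans ?_
      simp only [smul_eq_mul, abs_mul]
      gcongr
      · exact mul_le_of_le_one_left (abs_nonneg _) hz1
      · exact mul_le_of_le_one_left (abs_nonneg _) hz2
    simp only [smul_apply, ContinuousLinearMap.id_apply, smul_eq_mul, abs_mul]
      at hW ⊢
    rw [← mul_add]
    refine mul_le_mul_of_nonneg_right ((hx _).trans ?_) (by positivity)
    gcongr

end NemytskiiGrowth

end Nemytskii

/-! ### Dominated convergence in `L^q` -/

/-- Dominated convergence in `L^q`. -/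
theorem tendsto_eLpNorm_sub_of_dominated {X E : Type*} [MeasurableSpace X] {μ : Measure X}
    [NormedAddCommGroup E] {q : ℝ} (hq : 1 < q) {F : ℕ → X → E} {f : X → E} {b : X → ℝ}
    (hF : ∀ n, AEStronglyMeasurable (F n) μ) (hb : MemLp b (ENNReal.ofReal q) μ)
    (hle : ∀ n, ∀ᵐ x ∂μ, ‖F n x‖ ≤ b x)
    (hlim : ∀ᵐ x ∂μ, Tendsto (fun n => F n x) atTop (𝓝 (f x))) :
    MemLp f (ENNReal.ofReal q) μ ∧
      Tendsto (fun n => eLpNorm (F n - f) (ENNReal.ofReal q) μ) atTop (𝓝 0) := by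
  have hq0 : 0 < q := by linarith
  have hf : AEStronglyMeasurable f μ := aestronglyMeasurable_of_tendsto_ae atTop hF hlim
  have hfb : ∀ᵐ x ∂μ, ‖f x‖ ≤ b x := by
    filter_upwards [ae_all_iff.2 hle, hlim] with x h1 h2
    exact le_of_tendsto' h2.norm h1
  refine ⟨hb.mono' hf hfb, ?_⟩
  have hlp : ∀ n, eLpNorm (F n - f) (ENNReal.ofReal q) μ
      = (∫⁻ x, ‖F n x - f x‖ₑ ^ q ∂μ) ^ (1 / q) := by
    intro n
    rw [eLpNorm_eq_lintegral_rpow_enorm_toReal (by simpa using hq0) (by simp),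
      ENNReal.toReal_ofReal hq0.le]
    rfl
  have hlim0 : Tendsto (fun n => ∫⁻ x, ‖F n x - f x‖ₑ ^ q ∂μ) atTop (𝓝 0) := by
    have h2b : MemLp (fun x => 2 * b x) (ENNReal.ofReal q) μ := hb.const_mul 2
    have := tendsto_lintegral_of_dominated_convergence' (μ := μ)
      (F := fun n x => ‖F n x - f x‖ₑ ^ q) (f := fun _ => 0) (fun x => ‖2 * b x‖ₑ ^ q)
      (fun n => ((hF n).sub hf).enorm.pow_const q) ?_ ?_ ?_
    · simpa using this
    · intro n
      filter_upwards [hle n, hfb] with x h1 h2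
      refine ENNReal.rpow_le_rpow ?_ hq0.le
      rw [enorm_le_iff_norm_le]
      refine (norm_sub_le _ _).trans ?_
      rw [Real.norm_eq_abs]
      exact le_trans (by linarith) (le_abs_self _)
    · have := lintegral_rpow_enorm_lt_top_of_eLpNorm_lt_top (by simpa using hq0) (by simp) h2b.2
      rw [ENNReal.toReal_ofReal hq0.le] at this
      exact this.ne
    · filter_upwards [hlim] with x hx
      have h1 : Tendsto (fun n => ‖F n x - f x‖ₑ) atTop (𝓝 0) := by
        have := (hx.sub_const (f x)).enorm
        simpa using this
      have h2 := (ENNReal.continuous_rpow_const (y := q)).tendsto 0 |>.comp h1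
      rw [ENNReal.zero_rpow_of_pos hq0] at h2
      exact h2
  simp only [hlp]
  have h2 := (ENNReal.continuous_rpow_const (y := 1 / q)).tendsto 0 |>.comp hlim0
  have h3 : 0 < 1 / q := by positivity
  rw [ENNReal.zero_rpow_of_pos h3] at h2
  exact h2

/-! ### Test functions -/

section TestFunctions

variable {N : ℕ} {Ω : Set (RN N)} {φ : RN N → ℝ}

theorem continuous_gradient_of_contDiff (hφ : ContDiff ℝ ∞ φ) : Continuous (gradient φ) := by
  have h : Continuous (fderiv ℝ φ) := hφ.continuous_fderiv (by simp)
  exact (InnerProductSpace.toDual ℝ (RN N)).symm.continuous.comp h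

theorem norm_gradient (x : RN N) : ‖gradient φ x‖ = ‖fderiv ℝ φ x‖ := by
  simp [gradient]

theorem support_gradient_subset : Function.support (gradient φ) ⊆ tsupport φ := by
  intro x hx
  refine support_fderiv_subset ℝ (f := φ) ?_
  rw [Function.mem_support] at hx ⊢
  intro h
  exact hx (by simp [gradient, h])

theorem hasCompactSupport_gradient (hφ : HasCompactSupport φ) :
    HasCompactSupport (gradient φ) :=
  hφ.mono' support_gradient_subset

namespace IsTestFunction

theorem memLp (hφ : IsTestFunction Ω φ) (q : ℝ≥0∞) (μ : Measure (RN N))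
    [IsFiniteMeasureOnCompacts μ] : MemLp φ q μ :=
  hφ.smooth.continuous.memLp_of_hasCompactSupport hφ.compact

theorem memLp_gradient (hφ : IsTestFunction Ω φ) (q : ℝ≥0∞) (μ : Measure (RN N))
    [IsFiniteMeasureOnCompacts μ] : MemLp (gradient φ) q μ :=
  (continuous_gradient_of_contDiff hφ.smooth).memLp_of_hasCompactSupport
    (hasCompactSupport_gradient hφ.compact)

/-- Composition with a smooth function vanishing at `0` preserves test functions. -/
theorem comp (hφ : IsTestFunction Ω φ) {h : ℝ → ℝ} (hh : ContDiff ℝ ∞ h) (h0 : h 0 = 0) :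
    IsTestFunction Ω (h ∘ φ) where
  smooth := hh.comp hφ.smooth
  compact := hφ.compact.comp_left h0
  support := (tsupport_comp_subset h0 φ).trans hφ.support

theorem gradient_comp (hφ : IsTestFunction Ω φ) {h : ℝ → ℝ} (hh : ContDiff ℝ ∞ h) (x : RN N) :
    gradient (h ∘ φ) x = deriv h (φ x) • gradient φ x := by
  have d1 : DifferentiableAt ℝ φ x := hφ.smooth.differentiable (by simp) x
  have d2 : DifferentiableAt ℝ h (φ x) := hh.differentiable (by simp) _
  have : fderiv ℝ (h ∘ φ) x = deriv h (φ x) • fderiv ℝ φ x :=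
    (d2.hasDerivAt.comp_hasFDerivAt x d1.hasFDerivAt).fderiv
  simp [gradient, this]

end IsTestFunction

theorem integral_smul_gradient_eq_neg {φ ψ : RN N → ℝ} (hφ : ContDiff ℝ ∞ φ) (hψ : ContDiff ℝ ∞ ψ)
    (hφc : HasCompactSupport φ) (hψc : HasCompactSupport ψ) :
    ∫ x, ψ x • gradient φ x = -∫ x, φ x • gradient ψ x := by
  have cφ := continuous_gradient_of_contDiff hφ
  have cψ := continuous_gradient_of_contDiff hψ
  have i1 : Integrable (fun x => ψ x • gradient φ x) :=
    (hψ.continuous.smul cφ).integrable_of_hasCompactSupport hψc.smul_right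
  have i2 : Integrable (fun x => φ x • gradient ψ x) :=
    (hφ.continuous.smul cψ).integrable_of_hasCompactSupport hφc.smul_right
  refine ext_inner_left ℝ fun e => ?_
  rw [inner_neg_right, ← integral_inner i1, ← integral_inner i2]
  have k1 : ∀ x, inner ℝ e (ψ x • gradient φ x) = ψ x * fderiv ℝ φ x e := by
    intro x
    rw [inner_smul_right, real_inner_comm, inner_gradient_left]
  have k2 : ∀ x, inner ℝ e (φ x • gradient ψ x) = fderiv ℝ ψ x e * φ x := by
    intro x
    rw [inner_smul_right, real_inner_comm, inner_gradient_left, mul_comm]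
  have j1 := i1.const_inner (𝕜 := ℝ) e
  have j2 := i2.const_inner (𝕜 := ℝ) e
  simp only [k1, k2] at j1 j2 ⊢
  exact integral_mul_fderiv_eq_neg_fderiv_mul_of_integrable j2 j1
    ((hψ.continuous.mul hφ.continuous).integrable_of_hasCompactSupport hψc.mul_right)
    (fun x _ => hψ.differentiable (by simp) x) (fun x _ => hφ.differentiable (by simp) x)

end TestFunctions

/-! ### The space `W_0^{1,p}`: chain rule, integration by parts, gradients on zero sets -/

namespace W0

variable {N : ℕ} {p : ℝ} [hp : Fact (1 < p)] {Ω : Set (RN N)}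

theorem memLp_val (u : W0 p Ω) : MemLp (val u) (ENNReal.ofReal p) (volume.restrict Ω) :=
  Lp.memLp _

theorem memLp_grad (u : W0 p Ω) : MemLp (grad u) (ENNReal.ofReal p) (volume.restrict Ω) :=
  Lp.memLp _

theorem val_add (u v : W0 p Ω) : val (u + v) =ᵐ[volume.restrict Ω] val u + val v :=
  Lp.coeFn_add u.1.1 v.1.1

theorem grad_add (u v : W0 p Ω) : grad (u + v) =ᵐ[volume.restrict Ω] grad u + grad v :=
  Lp.coeFn_add u.1.2 v.1.2

theorem val_sub (u v : W0 p Ω) : val (u - v) =ᵐ[volume.restrict Ω] val u - val v :=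
  Lp.coeFn_sub u.1.1 v.1.1

theorem grad_sub (u v : W0 p Ω) : grad (u - v) =ᵐ[volume.restrict Ω] grad u - grad v :=
  Lp.coeFn_sub u.1.2 v.1.2

theorem val_smul (c : ℝ) (u : W0 p Ω) : val (c • u) =ᵐ[volume.restrict Ω] c • val u :=
  Lp.coeFn_smul c u.1.1

theorem grad_smul (c : ℝ) (u : W0 p Ω) : grad (c • u) =ᵐ[volume.restrict Ω] c • grad u :=
  Lp.coeFn_smul c u.1.2

theorem tendsto_eLpNorm_val {ι : Type*} {l : Filter ι} {w : ι → W0 p Ω} {u : W0 p Ω}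
    (h : Tendsto w l (𝓝 u)) :
    Tendsto (fun n => eLpNorm (val (w n) - val u) (ENNReal.ofReal p) (volume.restrict Ω)) l
      (𝓝 0) := by
  rw [tendsto_subtype_rng] at h
  exact (Lp.tendsto_Lp_iff_tendsto_eLpNorm' _ _).1 ((continuous_fst.tendsto _).comp h)

theorem tendsto_eLpNorm_grad {ι : Type*} {l : Filter ι} {w : ι → W0 p Ω} {u : W0 p Ω}
    (h : Tendsto w l (𝓝 u)) :
    Tendsto (fun n => eLpNorm (grad (w n) - grad u) (ENNReal.ofReal p) (volume.restrict Ω)) l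
      (𝓝 0) := by
  rw [tendsto_subtype_rng] at h
  exact (Lp.tendsto_Lp_iff_tendsto_eLpNorm' _ _).1 ((continuous_snd.tendsto _).comp h)

/-- Convergence in `W_0^{1,p}` yields convergence almost everywhere of the functions and of their
gradients along a subsequence. -/
theorem exists_subseq_tendsto_ae {w : ℕ → W0 p Ω} {u : W0 p Ω} (h : Tendsto w atTop (𝓝 u)) :
    ∃ ns : ℕ → ℕ, StrictMono ns ∧
      (∀ᵐ x ∂volume.restrict Ω, Tendsto (fun n => val (w (ns n)) x) atTop (𝓝 (val u x))) ∧
      ∀ᵐ x ∂volume.restrict Ω, Tendsto (fun n => grad (w (ns n)) x) atTop (𝓝 (grad u x)) := by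
  have hp0 : ENNReal.ofReal p ≠ 0 := by
    have := hp.out
    simp; linarith
  obtain ⟨n1, m1, h1⟩ := (tendstoInMeasure_of_tendsto_eLpNorm hp0
    (fun n => (memLp_val (w n)).1) (memLp_val u).1 (tendsto_eLpNorm_val h)).exists_seq_tendsto_ae
  obtain ⟨n2, m2, h2⟩ := (tendstoInMeasure_of_tendsto_eLpNorm hp0
    (fun n => (memLp_grad (w (n1 n))).1) (memLp_grad u).1
    ((tendsto_eLpNorm_grad h).comp m1.tendsto_atTop)).exists_seq_tendsto_ae
  refine ⟨n1 ∘ n2, m1.comp m2, ?_, h2⟩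
  filter_upwards [h1] with x hx
  exact hx.comp m2.tendsto_atTop

theorem exists_of_isTestFunction {φ : RN N → ℝ} (hφ : IsTestFunction Ω φ) :
    ∃ w : W0 p Ω, val w =ᵐ[volume.restrict Ω] φ ∧
      grad w =ᵐ[volume.restrict Ω] gradient φ := by
  have m1 := hφ.memLp (ENNReal.ofReal p) (volume.restrict Ω)
  have m2 := hφ.memLp_gradient (ENNReal.ofReal p) (volume.restrict Ω)
  refine ⟨⟨(m1.toLp φ, m2.toLp _), Submodule.le_topologicalClosure _ ?_⟩, m1.coeFn_toLp,
    m2.coeFn_toLp⟩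
  exact ⟨φ, hφ, m1.coeFn_toLp, m2.coeFn_toLp⟩

theorem coe_mem_closure_testPairs (u : W0 p Ω) :
    u.1 ∈ closure (testPairs p Ω : Set (Lp ℝ (ENNReal.ofReal p) (volume.restrict Ω) ×
      Lp (RN N) (ENNReal.ofReal p) (volume.restrict Ω))) := by
  rw [← Submodule.topologicalClosure_coe]
  exact u.2

theorem exists_seq_isTestFunction (u : W0 p Ω) :
    ∃ (w : ℕ → W0 p Ω) (φ : ℕ → RN N → ℝ), Tendsto w atTop (𝓝 u) ∧ ∀ n, IsTestFunction Ω (φ n) ∧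
      val (w n) =ᵐ[volume.restrict Ω] φ n ∧ grad (w n) =ᵐ[volume.restrict Ω] gradient (φ n) := by
  obtain ⟨w, hw, hu⟩ := mem_closure_iff_seq_limit.1 (coe_mem_closure_testPairs u)
  choose φ hφ h1 h2 using hw
  exact ⟨fun n => ⟨w n, Submodule.le_topologicalClosure _ ⟨φ n, hφ n, h1 n, h2 n⟩⟩, φ,
    tendsto_subtype_rng.2 hu, fun n => ⟨hφ n, h1 n, h2 n⟩⟩

/-- `W_0^{1,p}` is closed in `L^p × L^p`. -/
theorem exists_of_tendsto {w : ℕ → W0 p Ω} {v : RN N → ℝ} {V : RN N → RN N}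
    (hv : MemLp v (ENNReal.ofReal p) (volume.restrict Ω))
    (hV : MemLp V (ENNReal.ofReal p) (volume.restrict Ω))
    (h1 : Tendsto (fun n => eLpNorm (val (w n) - v) (ENNReal.ofReal p) (volume.restrict Ω))
      atTop (𝓝 0))
    (h2 : Tendsto (fun n => eLpNorm (grad (w n) - V) (ENNReal.ofReal p) (volume.restrict Ω))
      atTop (𝓝 0)) :
    ∃ u : W0 p Ω, val u =ᵐ[volume.restrict Ω] v ∧ grad u =ᵐ[volume.restrict Ω] V := by
  have t1 : Tendsto (fun n => (w n).1.1) atTop (𝓝 (hv.toLp v)) := by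
    rw [Lp.tendsto_Lp_iff_tendsto_eLpNorm']
    refine h1.congr fun n => eLpNorm_congr_ae ?_
    filter_upwards [hv.coeFn_toLp] with x hx
    simp [hx, val]
  have t2 : Tendsto (fun n => (w n).1.2) atTop (𝓝 (hV.toLp V)) := by
    rw [Lp.tendsto_Lp_iff_tendsto_eLpNorm']
    refine h2.congr fun n => eLpNorm_congr_ae ?_
    filter_upwards [hV.coeFn_toLp] with x hx
    simp [hx, grad]
  have t3 : Tendsto (fun n => (w n).1) atTop (𝓝 (hv.toLp v, hV.toLp V)) := t1.prodMk_nhds t2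
  have mem : (hv.toLp v, hV.toLp V) ∈ W0 p Ω :=
    (Submodule.isClosed_topologicalClosure _).mem_of_tendsto t3
      (Eventually.of_forall fun n => (w n).2)
  exact ⟨⟨_, mem⟩, hv.coeFn_toLp, hV.coeFn_toLp⟩

/-- The chain rule in `W_0^{1,p}`, for smooth functions with bounded derivative. -/
theorem exists_comp (u : W0 p Ω) {h : ℝ → ℝ} (hh : ContDiff ℝ ∞ h) (h0 : h 0 = 0) {L : ℝ}
    (hL : ∀ s, |deriv h s| ≤ L) :
    ∃ w : W0 p Ω, val w =ᵐ[volume.restrict Ω] (fun x => h (val u x)) ∧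
      grad w =ᵐ[volume.restrict Ω] fun x => deriv h (val u x) • grad u x := by
  obtain ⟨w0, φ0, hw0, hφ0⟩ := exists_seq_isTestFunction u
  obtain ⟨ns, hns, ae1, -⟩ := exists_subseq_tendsto_ae hw0
  set w : ℕ → W0 p Ω := fun n => w0 (ns n) with hw_def
  have hw : Tendsto w atTop (𝓝 u) := hw0.comp hns.tendsto_atTop
  have hp1 : (1 : ℝ≥0∞) ≤ ENNReal.ofReal p := Fact.out
  have hL0 : 0 ≤ L := (abs_nonneg _).trans (hL 0)
  have hd : Continuous (deriv h) := hh.continuous_deriv (by simp)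
  have hlip : ∀ a b, |h a - h b| ≤ L * |a - b| := fun a b => by
    have := Convex.norm_image_sub_le_of_norm_deriv_le (𝕜 := ℝ) (f := h) (C := L) (s := univ)
      (x := b) (y := a) (fun x _ => hh.differentiable (by simp) x) (fun x _ => hL x) convex_univ
      (mem_univ _) (mem_univ _)
    simpa using this
  have hcomp : ∀ n, ∃ y : W0 p Ω, val y =ᵐ[volume.restrict Ω] (fun x => h (val (w n) x)) ∧
      grad y =ᵐ[volume.restrict Ω] fun x => deriv h (val (w n) x) • grad (w n) x := by
    intro n
    obtain ⟨t, e1, e2⟩ := hφ0 (ns n)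
    obtain ⟨y, y1, y2⟩ := exists_of_isTestFunction (p := p) (t.comp hh h0)
    refine ⟨y, ?_, ?_⟩
    · filter_upwards [y1, e1] with x a b
      rw [a, hw_def]
      simp [b]
    · filter_upwards [y2, e1, e2] with x a b c
      rw [a, t.gradient_comp hh, hw_def]
      simp [b, c]
  choose y y1 y2 using hcomp
  have mval : MemLp (fun x => h (val u x)) (ENNReal.ofReal p) (volume.restrict Ω) := by
    refine MemLp.of_le_mul (c := L) (memLp_val u)
      (hh.continuous.comp_aestronglyMeasurable (memLp_val u).1) (Eventually.of_forall fun x => ?_)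
    have := hlip (val u x) 0
    simpa [h0] using this
  have mgrad : MemLp (fun x => deriv h (val u x) • grad u x) (ENNReal.ofReal p)
      (volume.restrict Ω) := by
    refine MemLp.of_le_mul (c := L) (memLp_grad u)
      ((hd.comp_aestronglyMeasurable (memLp_val u).1).smul (memLp_grad u).1)
      (Eventually.of_forall fun x => ?_)
    rw [norm_smul]
    exact mul_le_mul_of_nonneg_right (hL _) (norm_nonneg _)
  refine exists_of_tendsto (w := y) mval mgrad ?_ ?_
  · have t := ENNReal.Tendsto.const_mul (a := ENNReal.ofReal L) (tendsto_eLpNorm_val hw)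
      (Or.inr ENNReal.ofReal_ne_top)
    rw [mul_zero] at t
    refine tendsto_of_tendsto_of_tendsto_of_le_of_le tendsto_const_nhds t (fun _ => bot_le)
      fun n => ?_
    refine eLpNorm_le_mul_eLpNorm_of_ae_le_mul ?_ _
    filter_upwards [y1 n] with x hx
    simp only [Pi.sub_apply, hx, Real.norm_eq_abs]
    exact hlip _ _
  · -- `h'(u_n) Du_n - h'(u) Du = h'(u_n) (Du_n - Du) + (h'(u_n) - h'(u)) Du`
    have t1 := ENNReal.Tendsto.const_mul (a := ENNReal.ofReal L) (tendsto_eLpNorm_grad hw)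
      (Or.inr ENNReal.ofReal_ne_top)
    rw [mul_zero] at t1
    have t2 := (tendsto_eLpNorm_sub_of_dominated (μ := volume.restrict Ω) hp.out
      (F := fun n x => deriv h (val (w n) x) • grad u x)
      (f := fun x => deriv h (val u x) • grad u x) (b := fun x => L * ‖grad u x‖)
      (fun n => (hd.comp_aestronglyMeasurable (memLp_val (w n)).1).smul (memLp_grad u).1)
      ((memLp_grad u).norm.const_mul L)
      (fun n => Eventually.of_forall fun x => by
        rw [norm_smul]
        exact mul_le_mul_of_nonneg_right (hL _) (norm_nonneg _))
      (by
        filter_upwards [ae1] with x hx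
        exact ((hd.tendsto _).comp hx).smul_const _)).2
    have t3 := t1.add t2
    rw [add_zero] at t3
    refine tendsto_of_tendsto_of_tendsto_of_le_of_le tendsto_const_nhds t3 (fun _ => bot_le)
      fun n => ?_
    have hdn := hd.comp_aestronglyMeasurable (memLp_val (w n)).1
    have hdu := hd.comp_aestronglyMeasurable (memLp_val u).1
    calc eLpNorm (grad (y n) - fun x => deriv h (val u x) • grad u x) (ENNReal.ofReal p)
          (volume.restrict Ω)
        = eLpNorm ((fun x => deriv h (val (w n) x) • (grad (w n) - grad u) x)
            + ((fun x => deriv h (val (w n) x) • grad u x)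
              - fun x => deriv h (val u x) • grad u x)) (ENNReal.ofReal p)
          (volume.restrict Ω) := by
          refine eLpNorm_congr_ae ?_
          filter_upwards [y2 n] with x hx
          simp only [Pi.sub_apply, Pi.add_apply, hx, smul_sub]
          abel
      _ ≤ _ := eLpNorm_add_le (hdn.smul ((memLp_grad (w n)).1.sub (memLp_grad u).1))
          ((hdn.smul (memLp_grad u).1).sub (hdu.smul (memLp_grad u).1)) hp1
      _ ≤ _ := by
          refine add_le_add ?_ le_rfl
          refine eLpNorm_le_mul_eLpNorm_of_ae_le_mul (Eventually.of_forall fun x => ?_) _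
          rw [norm_smul]
          exact mul_le_mul_of_nonneg_right (hL _) (norm_nonneg _)

/-- Integration by parts in `W_0^{1,p}`. -/
theorem integral_smul_grad_eq_neg (u : W0 p Ω) {ψ : RN N → ℝ} (hψ : IsTestFunction Ω ψ) :
    ∫ x in Ω, ψ x • grad u x = -∫ x in Ω, val u x • gradient ψ x := by
  have hq : ENNReal.HolderConjugate (ENNReal.ofReal (p / (p - 1))) (ENNReal.ofReal p) :=
    holderConjugate_ofReal hp.out
  have : Fact (1 ≤ ENNReal.ofReal (p / (p - 1))) := ⟨hq.one_le⟩
  have m1 := hψ.memLp (ENNReal.ofReal (p / (p - 1))) (volume.restrict Ω)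
  have m2 := hψ.memLp_gradient (ENNReal.ofReal (p / (p - 1))) (volume.restrict Ω)
  let P1 := (ContinuousLinearMap.lsmul ℝ ℝ (E := RN N)).lpPairing (volume.restrict Ω)
    (ENNReal.ofReal (p / (p - 1))) (ENNReal.ofReal p) (m1.toLp ψ)
  let P2 := (ContinuousLinearMap.lsmul ℝ ℝ (E := RN N)).flip.lpPairing (volume.restrict Ω)
    (ENNReal.ofReal (p / (p - 1))) (ENNReal.ofReal p) (m2.toLp _)
  have e1 : ∀ w : Lp (RN N) (ENNReal.ofReal p) (volume.restrict Ω),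
      P1 w = ∫ x in Ω, ψ x • w x := by
    intro w
    rw [ContinuousLinearMap.lpPairing_eq_integral]
    refine integral_congr_ae ?_
    filter_upwards [m1.coeFn_toLp] with x hx
    simp [hx]
  have e2 : ∀ w : Lp ℝ (ENNReal.ofReal p) (volume.restrict Ω),
      P2 w = ∫ x in Ω, w x • gradient ψ x := by
    intro w
    rw [ContinuousLinearMap.lpPairing_eq_integral]
    refine integral_congr_ae ?_
    filter_upwards [m2.coeFn_toLp] with x hx
    simp [hx]
  have hcl : IsClosed {w : Lp ℝ (ENNReal.ofReal p) (volume.restrict Ω) ×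
      Lp (RN N) (ENNReal.ofReal p) (volume.restrict Ω) | P1 w.2 = -P2 w.1} :=
    isClosed_eq (P1.continuous.comp continuous_snd) (P2.continuous.comp continuous_fst).neg
  have hsub : (testPairs p Ω : Set (Lp ℝ (ENNReal.ofReal p) (volume.restrict Ω) ×
      Lp (RN N) (ENNReal.ofReal p) (volume.restrict Ω))) ⊆ {w | P1 w.2 = -P2 w.1} := by
    rintro w ⟨φ, hφ, h1, h2⟩
    rw [mem_ofPred_eq, e1, e2]
    have k1 : ∫ x in Ω, ψ x • w.2 x = ∫ x, ψ x • gradient φ x := by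
      rw [← setIntegral_eq_integral_of_forall_compl_eq_zero (s := Ω)
        (f := fun x => ψ x • gradient φ x)]
      · refine integral_congr_ae ?_
        filter_upwards [h2] with x hx
        rw [hx]
      · intro x hx
        rw [image_eq_zero_of_notMem_tsupport (fun h => hx (hψ.support h)), zero_smul]
    have k2 : ∫ x in Ω, w.1 x • gradient ψ x = ∫ x, φ x • gradient ψ x := by
      rw [← setIntegral_eq_integral_of_forall_compl_eq_zero (s := Ω)
        (f := fun x => φ x • gradient ψ x)]
      · refine integral_congr_ae ?_
        filter_upwards [h1] with x hx
        rw [hx]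
      · intro x hx
        rw [image_eq_zero_of_notMem_tsupport (fun h => hx (hφ.support h)), zero_smul]
    rw [k1, k2]
    exact integral_smul_gradient_eq_neg hφ.smooth hψ.smooth hφ.compact hψ.compact
  have := closure_minimal hsub hcl (coe_mem_closure_testPairs u)
  rw [mem_ofPred_eq, e1, e2] at this
  exact this

theorem grad_ae_eq_zero_of_val_ae_eq_zero (hΩ : IsOpen Ω) {u : W0 p Ω}
    (hu : val u =ᵐ[volume.restrict Ω] 0) : grad u =ᵐ[volume.restrict Ω] 0 := by
  have hp1 : (1 : ℝ≥0∞) ≤ ENNReal.ofReal p := Fact.out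
  have := hΩ.ae_eq_zero_of_integral_contDiff_smul_eq_zero (μ := volume) (f := grad u)
    (locallyIntegrableOn_of_locallyIntegrable_restrict ((memLp_grad u).locallyIntegrable hp1)) ?_
  · exact (ae_restrict_iff' hΩ.measurableSet).2 this
  · intro ψ h1 h2 h3
    have hψ : IsTestFunction Ω ψ := ⟨h1, h2, h3⟩
    rw [← setIntegral_eq_integral_of_forall_compl_eq_zero (s := Ω), integral_smul_grad_eq_neg u hψ,
      neg_eq_zero]
    · refine integral_eq_zero_of_ae ?_
      filter_upwards [hu] with x hx
      simp [hx]
    · intro x hx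
      rw [image_eq_zero_of_notMem_tsupport (fun h => hx (h3 h)), zero_smul]

/-- The weak gradient vanishes almost everywhere on the zero set: the functions
`ε arctan (v / ε)` tend to `0` in `L^p` as `ε → 0`, while their gradients
`(1 + (v / ε)²)⁻¹ Dv` tend to `Dv` on the zero set and to `0` elsewhere. -/
theorem grad_eq_zero_of_val_eq_zero (hΩ : IsOpen Ω) (v : W0 p Ω) :
    ∀ᵐ x ∂volume.restrict Ω, val v x = 0 → grad v x = 0 := by
  have hder : ∀ (n : ℕ) (s : ℝ), HasDerivAt (fun s => ((n : ℝ) + 1)⁻¹ * Real.arctan ((n + 1) * s))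
      (1 + ((n + 1) * s) ^ 2)⁻¹ s := by
    intro n s
    have h1 := ((hasDerivAt_id s).const_mul ((n : ℝ) + 1)).arctan.const_mul ((n : ℝ) + 1)⁻¹
    refine h1.congr_deriv ?_
    have : (n : ℝ) + 1 ≠ 0 := by positivity
    field_simp
    simp
  have hsm : ∀ n : ℕ, ContDiff ℝ ∞ (fun s : ℝ => ((n : ℝ) + 1)⁻¹ * Real.arctan ((n + 1) * s)) :=
    fun n => contDiff_const.mul (Real.contDiff_arctan.comp (contDiff_const.mul contDiff_id))
  have hb : ∀ (n : ℕ) (s : ℝ), |(1 + (((n : ℝ) + 1) * s) ^ 2)⁻¹| ≤ 1 := by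
    intro n s
    rw [abs_of_nonneg (by positivity)]
    exact inv_le_one_of_one_le₀ (by nlinarith [sq_nonneg (((n : ℝ) + 1) * s)])
  have hw : ∀ n : ℕ, ∃ w : W0 p Ω, val w =ᵐ[volume.restrict Ω]
        (fun x => ((n : ℝ) + 1)⁻¹ * Real.arctan ((n + 1) * val v x)) ∧
      grad w =ᵐ[volume.restrict Ω] fun x => (1 + ((n + 1) * val v x) ^ 2)⁻¹ • grad v x := by
    intro n
    have := exists_comp v (hsm n) (by simp) (L := 1) (fun s => by
      rw [(hder n s).deriv]
      exact hb n s)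
    simpa only [fun s => (hder n s).deriv] using this
  choose w w1 w2 using hw
  set V : RN N → RN N := {x | val v x = 0}.indicator (grad v) with hV
  have a1 := tendsto_eLpNorm_sub_of_dominated (μ := volume.restrict Ω) hp.out
    (F := fun n => val (w n)) (f := fun _ => (0 : ℝ)) (b := fun x => |val v x|)
    (fun n => (memLp_val (w n)).1) (memLp_val v).norm
    (fun n => by
      filter_upwards [w1 n] with x hx
      have hpos : (0 : ℝ) < (n : ℝ) + 1 := by positivity
      have h1 : |Real.arctan ((n + 1) * val v x)| ≤ |(n + 1) * val v x| := by
        have := Convex.norm_image_sub_le_of_norm_hasDerivWithin_le (𝕜 := ℝ) (f := Real.arctan)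
          (f' := fun s => 1 / (1 + s ^ 2)) (C := 1) (s := univ) (x := 0) (y := (n + 1) * val v x)
          (fun x _ => (Real.hasDerivAt_arctan x).hasDerivWithinAt) (fun s _ => by
            rw [Real.norm_eq_abs, abs_of_nonneg (by positivity)]
            exact div_le_one_of_le₀ (by nlinarith [sq_nonneg s]) (by positivity))
          convex_univ (mem_univ _) (mem_univ _)
        simpa using this
      rw [hx, Real.norm_eq_abs, abs_mul, abs_of_pos (inv_pos.2 hpos), inv_mul_le_iff₀ hpos]
      rwa [abs_mul, abs_of_pos hpos] at h1)
    (by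
      filter_upwards [ae_all_iff.2 w1] with x hx
      simp only [hx]
      refine squeeze_zero_norm (a := fun n : ℕ => ((n : ℝ) + 1)⁻¹ * (Real.pi / 2)) (fun n => ?_) ?_
      · rw [norm_mul, Real.norm_eq_abs, abs_of_pos (by positivity), Real.norm_eq_abs]
        have : |Real.arctan ((n + 1) * val v x)| ≤ Real.pi / 2 :=
          abs_le.2 ⟨(Real.neg_pi_div_two_lt_arctan _).le, (Real.arctan_lt_pi_div_two _).le⟩
        gcongr
      · have := tendsto_one_div_add_atTop_nhds_zero_nat (𝕜 := ℝ)
        simpa using this.mul_const (Real.pi / 2))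
  have a2 := tendsto_eLpNorm_sub_of_dominated (μ := volume.restrict Ω) hp.out
    (F := fun n => grad (w n)) (f := V) (b := fun x => ‖grad v x‖)
    (fun n => (memLp_grad (w n)).1) (memLp_grad v).norm
    (fun n => by
      filter_upwards [w2 n] with x hx
      rw [hx, norm_smul]
      exact mul_le_of_le_one_left (norm_nonneg _) (hb n _))
    (by
      filter_upwards [ae_all_iff.2 w2] with x hx
      simp only [hx]
      by_cases h0 : val v x = 0
      · simp [hV, h0]
      · have hx0 : V x = (0 : ℝ) • grad v x := by simp [hV, h0]
        rw [hx0]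
        refine Tendsto.smul_const ?_ _
        refine tendsto_inv_atTop_zero.comp (tendsto_atTop_add_const_left _ _ ?_)
        have h1 : Tendsto (fun n : ℕ => ((n : ℝ) + 1) ^ 2 * val v x ^ 2) atTop atTop := by
          refine Tendsto.atTop_mul_const (by positivity) ?_
          exact (tendsto_pow_atTop (by norm_num)).comp
            (tendsto_atTop_add_const_right _ _ tendsto_natCast_atTop_atTop)
        refine h1.congr fun n => by ring)
  obtain ⟨z, z1, z2⟩ := exists_of_tendsto a1.1 a2.1 a1.2 a2.2
  have := grad_ae_eq_zero_of_val_ae_eq_zero hΩ (u := z) z1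
  filter_upwards [this, z2] with x h1 h2 h0
  rw [h2] at h1
  simpa [hV, h0] using h1

end W0

/-! ### The Sobolev inequality -/

section SobolevInequality

variable {N : ℕ} {p : ℝ}

theorem lt_sobolevExp (hp : 0 < p) (hpN : p < N) : p < sobolevExp N p := by
  rw [sobolevExp, lt_div_iff₀ (by linarith)]
  nlinarith

theorem one_lt_sobolevExp (hp : 1 < p) (hpN : p < N) : 1 < sobolevExp N p :=
  hp.trans (lt_sobolevExp (by linarith) hpN)

theorem sobolevExp_conjugate (hpN : p < N) :
    sobolevExp N p / (sobolevExp N p - 1) = N * p / (N * (p - 1) + p) := by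
  have h0 : (N : ℝ) - p ≠ 0 := by linarith
  have h1 : sobolevExp N p - 1 = (N * (p - 1) + p) / (N - p) := by
    rw [sobolevExp]
    field_simp
    ring
  rw [h1, sobolevExp, div_div_div_cancel_right₀ h0]

namespace W0

variable [hp : Fact (1 < p)] {Ω : Set (RN N)}

/-- The Sobolev inequality `‖u‖_{p^*} ≤ C ‖Du‖_p`: it holds for test functions, hence by Fatou's
lemma for their limits. -/
theorem exists_eLpNorm_val_le (hpN : p < N) : ∃ C : NNReal, ∀ u : W0 p Ω,
    eLpNorm (val u) (ENNReal.ofReal (sobolevExp N p)) (volume.restrict Ω)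
      ≤ C * eLpNorm (grad u) (ENNReal.ofReal p) (volume.restrict Ω) := by
  have hp1 := hp.out
  have hs := one_lt_sobolevExp hp1 hpN
  set C := SNormLESNormFDerivOfEqConst ℝ (volume : Measure (RN N)) p.toNNReal with hC
  have test : ∀ φ : RN N → ℝ, IsTestFunction Ω φ →
      eLpNorm φ (ENNReal.ofReal (sobolevExp N p)) (volume.restrict Ω)
        ≤ C * eLpNorm (gradient φ) (ENNReal.ofReal p) (volume.restrict Ω) := by
    intro φ hφ
    have h := eLpNorm_le_eLpNorm_fderiv_of_eq (F := ℝ) (volume : Measure (RN N))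
      (hφ.smooth.of_le (by simp)) hφ.compact (p := p.toNNReal) (p' := (sobolevExp N p).toNNReal)
      (by rw [Real.one_le_toNNReal]; exact hp1.le)
      (by
        rw [finrank_euclideanSpace_fin]
        have : (0 : ℝ) < N := by linarith
        exact_mod_cast this)
      (by
        rw [finrank_euclideanSpace_fin, NNReal.coe_inv, Real.coe_toNNReal _ (by linarith),
          Real.coe_toNNReal _ (by linarith), sobolevExp]
        have : (N : ℝ) - p ≠ 0 := by linarith
        have : (N : ℝ) ≠ 0 := by linarith
        have : p ≠ 0 := by linarith
        field_simp)
    rw [eLpNorm_restrict_eq_of_support_subset (subset_closure.trans hφ.support),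
      eLpNorm_restrict_eq_of_support_subset (support_gradient_subset.trans hφ.support)]
    refine h.trans_eq ?_
    rw [eLpNorm_congr_norm_ae (f := gradient φ) (g := fderiv ℝ φ)
      (Eventually.of_forall norm_gradient)]
    rfl
  refine ⟨C, fun u => ?_⟩
  obtain ⟨w, φ, hw, hφ⟩ := exists_seq_isTestFunction u
  obtain ⟨ns, hns, ae1, -⟩ := exists_subseq_tendsto_ae hw
  have hp' : (1 : ℝ≥0∞) ≤ ENNReal.ofReal p := Fact.out
  have b1 : ∀ n, eLpNorm (val (w n)) (ENNReal.ofReal (sobolevExp N p)) (volume.restrict Ω)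
      ≤ C * eLpNorm (grad (w n)) (ENNReal.ofReal p) (volume.restrict Ω) := by
    intro n
    obtain ⟨t, e1, e2⟩ := hφ n
    rw [eLpNorm_congr_ae e1, eLpNorm_congr_ae e2]
    exact test _ t
  have b2 : ∀ n, eLpNorm (val (w (ns n))) (ENNReal.ofReal (sobolevExp N p)) (volume.restrict Ω)
      ≤ C * (eLpNorm (grad (w (ns n)) - grad u) (ENNReal.ofReal p) (volume.restrict Ω)
        + eLpNorm (grad u) (ENNReal.ofReal p) (volume.restrict Ω)) := by
    intro n
    refine (b1 _).trans ?_
    gcongr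
    have := eLpNorm_add_le ((memLp_grad (w (ns n))).1.sub (memLp_grad u).1) (memLp_grad u).1 hp'
    simpa using this
  have lim : Tendsto (fun n => (C : ℝ≥0∞) *
      (eLpNorm (grad (w (ns n)) - grad u) (ENNReal.ofReal p) (volume.restrict Ω)
        + eLpNorm (grad u) (ENNReal.ofReal p) (volume.restrict Ω))) atTop
      (𝓝 (C * eLpNorm (grad u) (ENNReal.ofReal p) (volume.restrict Ω))) := by
    have t1 := (tendsto_eLpNorm_grad hw).comp hns.tendsto_atTop
    have t2 := t1.add_const (eLpNorm (grad u) (ENNReal.ofReal p) (volume.restrict Ω))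
    rw [zero_add] at t2
    exact ENNReal.Tendsto.const_mul t2 (Or.inr ENNReal.coe_ne_top)
  calc _ ≤ liminf (fun n => eLpNorm (val (w (ns n))) (ENNReal.ofReal (sobolevExp N p))
        (volume.restrict Ω)) atTop :=
        Lp.eLpNorm_lim_le_liminf_eLpNorm (fun n => (memLp_val _).1) _ ae1
    _ ≤ _ := by
        rw [← lim.liminf_eq]
        exact liminf_le_liminf (Eventually.of_forall b2)

theorem memLp_val_sobolevExp (hpN : p < N) (u : W0 p Ω) :
    MemLp (val u) (ENNReal.ofReal (sobolevExp N p)) (volume.restrict Ω) := by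
  obtain ⟨C, hC⟩ := exists_eLpNorm_val_le (p := p) (Ω := Ω) hpN
  exact ⟨(memLp_val u).1,
    (hC u).trans_lt (ENNReal.mul_lt_top ENNReal.coe_lt_top (memLp_grad u).2)⟩

theorem tendsto_eLpNorm_val_sobolevExp (hpN : p < N) {ι : Type*} {l : Filter ι} {w : ι → W0 p Ω}
    {u : W0 p Ω} (h : Tendsto w l (𝓝 u)) :
    Tendsto (fun n => eLpNorm (val (w n) - val u) (ENNReal.ofReal (sobolevExp N p))
      (volume.restrict Ω)) l (𝓝 0) := by
  obtain ⟨C, hC⟩ := exists_eLpNorm_val_le (p := p) (Ω := Ω) hpN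
  have t := ENNReal.Tendsto.const_mul (a := (C : ℝ≥0∞)) (tendsto_eLpNorm_grad h)
    (Or.inr ENNReal.coe_ne_top)
  rw [mul_zero] at t
  refine tendsto_of_tendsto_of_tendsto_of_le_of_le tendsto_const_nhds t (fun _ => bot_le)
    fun n => ?_
  rw [← eLpNorm_congr_ae (val_sub (w n) u), ← eLpNorm_congr_ae (grad_sub (w n) u)]
  exact hC _

theorem val_ae_eq_zero_of_grad_ae_eq_zero (hpN : p < N) {u : W0 p Ω}
    (hu : grad u =ᵐ[volume.restrict Ω] 0) : val u =ᵐ[volume.restrict Ω] 0 := by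
  obtain ⟨C, hC⟩ := exists_eLpNorm_val_le (p := p) (Ω := Ω) hpN
  have hs := one_lt_sobolevExp hp.out hpN
  have h := hC u
  rw [eLpNorm_congr_ae hu, eLpNorm_zero, mul_zero, nonpos_iff_eq_zero] at h
  exact (eLpNorm_eq_zero_iff (memLp_val u).1 (by simp; linarith)).1 h

end W0

end SobolevInequality

/-! ### The lower order terms -/

section LowerOrderTerms

variable {N : ℕ} {p : ℝ} {Ω : Set (RN N)}

theorem AssumptionsG.nemytskiiGrowth {g : ℝ → ℝ} (hg : AssumptionsG N p g) :
    NemytskiiGrowth p (sobolevExp N p) (volume.restrict Ω) fun (_ : RN N) s => g s where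
  measurable := fun s => aestronglyMeasurable_const
  continuous := Eventually.of_forall fun _ => hg.continuous
  growth := by
    obtain ⟨C, hC, hgC⟩ := hg.growth
    refine ⟨C, hC.le, 0, MemLp.zero, Eventually.of_forall fun x s => (hgC s).trans_eq ?_⟩
    simp [mul_add]

theorem AssumptionsF.nemytskiiGrowth {f : ℝ → ℝ → ℝ} (hf : AssumptionsF p Ω f) (hpN : p < N) :
    NemytskiiGrowth p (sobolevExp N p) (volume.restrict Ω) fun (x : RN N) s => f ‖x‖ s where
  measurable := hf.measurable
  continuous := hf.continuous
  growth := by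
    obtain ⟨C, hC, a, ha, hfa⟩ := hf.growth
    refine ⟨C, hC.le, fun x => a ‖x‖, ?_, ?_⟩
    · rwa [sobolevExp_conjugate hpN]
    · filter_upwards [hfa] with x hx s
      refine (hx s).trans ?_
      have : 0 ≤ |s| ^ (p - 1) := by positivity
      gcongr
      linarith

variable [hp : Fact (1 < p)]

/-- The functional `u ↦ ∫ H(x, u)` with `H` the primitive of an integrand of critical growth is
continuous on `W_0^{1,p}`. -/
theorem NemytskiiGrowth.continuous_integral {h : RN N → ℝ → ℝ}
    (H : NemytskiiGrowth p (sobolevExp N p) (volume.restrict Ω) h) (hpN : p < N) :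
    Continuous fun u : W0 p Ω => ∫ x in Ω, ∫ τ in (0 : ℝ)..W0.val u x, h x τ := by
  rw [continuous_iff_continuousAt]
  intro u
  exact H.tendsto_integral_primitive hp.out (one_lt_sobolevExp hp.out hpN) (w := W0.val)
    W0.memLp_val (W0.memLp_val_sobolevExp hpN) (W0.memLp_val u) (W0.memLp_val_sobolevExp hpN u)
    (W0.tendsto_eLpNorm_val tendsto_id) (W0.tendsto_eLpNorm_val_sobolevExp hpN tendsto_id)

theorem continuous_integral_primF {f : ℝ → ℝ → ℝ} (hf : AssumptionsF p Ω f) (hpN : p < N) :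
    Continuous fun u : W0 p Ω => ∫ x in Ω, primF f ‖x‖ (W0.val u x) :=
  (hf.nemytskiiGrowth hpN).continuous_integral hpN

theorem continuous_integral_primG {g : ℝ → ℝ} (hg : AssumptionsG N p g) (hpN : p < N) :
    Continuous fun u : W0 p Ω => ∫ x in Ω, primG g (W0.val u x) :=
  hg.nemytskiiGrowth.continuous_integral hpN

end LowerOrderTerms

/-! ### The principal integrand -/

section PrincipalIntegrand

variable {N : ℕ} {p : ℝ} {j js jt : ℝ → ℝ → ℝ}

/-- The vector `j_t(s, |ξ|) ξ / |ξ|`, the gradient of `ξ ↦ j(s, |ξ|)`; it is `0` at `ξ = 0`. -/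
noncomputable def fluxVec (jt : ℝ → ℝ → ℝ) (z : ℝ × RN N) : RN N :=
  jt z.1 ‖z.2‖ • (‖z.2‖⁻¹ • z.2)

/-- The differential of `(s, ξ) ↦ j(s, |ξ|)`. -/
noncomputable def differentialJ (js jt : ℝ → ℝ → ℝ) (z : ℝ × RN N) : ℝ × RN N →L[ℝ] ℝ :=
  (js z.1 ‖z.2‖ • ContinuousLinearMap.id ℝ ℝ).coprod (innerSL ℝ (fluxVec jt z))

theorem differentialJ_apply (z w : ℝ × RN N) :
    differentialJ js jt z w = js z.1 ‖z.2‖ * w.1 + inner ℝ (fluxVec jt z) w.2 := by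
  simp [differentialJ]

theorem norm_inv_norm_smul_le {E : Type*} [NormedAddCommGroup E] [NormedSpace ℝ E] (ξ : E) :
    ‖‖ξ‖⁻¹ • ξ‖ ≤ 1 := by
  rw [norm_smul, norm_inv, norm_norm]
  exact inv_mul_le_one_of_le₀ le_rfl (norm_nonneg _)

theorem norm_fluxVec_le (z : ℝ × RN N) : ‖fluxVec jt z‖ ≤ |jt z.1 ‖z.2‖| := by
  rw [fluxVec, norm_smul]
  exact mul_le_of_le_one_right (norm_nonneg _) (norm_inv_norm_smul_le _)

namespace AssumptionsJ

theorem jt_zero (hj : AssumptionsJ N p j js jt) (hp : 1 < p) (s : ℝ) : jt s 0 = 0 := by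
  obtain ⟨γ, -, -, -, h⟩ := hj.growth_t
  have := h s 0
  rw [norm_zero, Real.zero_rpow (by linarith), mul_zero] at this
  exact abs_nonpos_iff.1 this

theorem continuous_js (hj : AssumptionsJ N p j js jt) :
    Continuous fun z : ℝ × RN N => js z.1 ‖z.2‖ :=
  hj.continuous_s.comp_continuous (continuous_fst.prodMk continuous_snd.norm)
    fun _ => ⟨mem_univ _, norm_nonneg _⟩

theorem continuous_jt (hj : AssumptionsJ N p j js jt) :
    Continuous fun z : ℝ × RN N => jt z.1 ‖z.2‖ :=
  hj.continuous_t.comp_continuous (continuous_fst.prodMk continuous_snd.norm)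
    fun _ => ⟨mem_univ _, norm_nonneg _⟩

theorem continuous_fluxVec (hj : AssumptionsJ N p j js jt) (hp : 1 < p) :
    Continuous (fluxVec jt : ℝ × RN N → RN N) := by
  rw [continuous_iff_continuousAt]
  rintro ⟨s, ξ⟩
  by_cases hξ : ξ = 0
  · subst hξ
    have h0 : fluxVec jt (s, (0 : RN N)) = 0 := by simp [fluxVec]
    rw [ContinuousAt, h0]
    refine squeeze_zero_norm norm_fluxVec_le ?_
    have := (hj.continuous_jt.abs).tendsto (s, (0 : RN N))
    simpa [hj.jt_zero hp] using this
  · have hn : ‖ξ‖ ≠ 0 := norm_ne_zero_iff.2 hξ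
    exact hj.continuous_jt.continuousAt.smul
      ((continuousAt_snd.norm.inv₀ hn).smul continuousAt_snd)

theorem hasFDerivAt_snd (hj : AssumptionsJ N p j js jt) (hp : 1 < p) (s : ℝ) (ξ : RN N) :
    HasFDerivAt (fun ξ : RN N => j s ‖ξ‖) (innerSL ℝ (fluxVec jt (s, ξ))) ξ := by
  by_cases hξ : ξ = 0
  · subst hξ
    have h0 : fluxVec jt (s, (0 : RN N)) = 0 := by simp [fluxVec]
    rw [h0, map_zero, hasFDerivAt_iff_isLittleO_nhds_zero]
    have h := (hj.hasDeriv_t s 0 self_mem_Ici)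
    rw [hj.jt_zero hp, hasDerivWithinAt_iff_isLittleO] at h
    have ht : Tendsto (fun ξ : RN N => ‖ξ‖) (𝓝 0) (𝓝[Ici 0] 0) :=
      tendsto_nhdsWithin_iff.2 ⟨by simpa using tendsto_norm_zero (E := RN N),
        Eventually.of_forall fun ξ => norm_nonneg ξ⟩
    rw [← Asymptotics.isLittleO_norm_right]
    simpa [Function.comp_def] using h.comp_tendsto ht
  · have hn : 0 < ‖ξ‖ := norm_pos_iff.2 hξ
    have h1 : HasDerivAt (j s) (jt s ‖ξ‖) ‖ξ‖ :=
      (hj.hasDeriv_t s ‖ξ‖ hn.le).hasDerivAt (Ici_mem_nhds hn)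
    have h2 : HasFDerivAt (fun ξ : RN N => ‖ξ‖) (innerSL ℝ (‖ξ‖⁻¹ • ξ)) ξ := by
      have := (hasStrictFDerivAt_norm_sq ξ).hasFDerivAt.sqrt (by positivity)
      simp only [Real.sqrt_sq (norm_nonneg _)] at this
      refine this.congr_fderiv ?_
      ext v
      simp
      field_simp
    refine (h1.comp_hasFDerivAt ξ h2).congr_fderiv ?_
    simp [fluxVec]

/-- The integrand `(s, ξ) ↦ j(s, |ξ|)` is of class `C¹`: since `j_t(s, 0) = 0`, the singularity of
the norm at `ξ = 0` is harmless. -/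
theorem hasFDerivAt (hj : AssumptionsJ N p j js jt) (hp : 1 < p) (z : ℝ × RN N) :
    HasFDerivAt (fun z : ℝ × RN N => j z.1 ‖z.2‖) (differentialJ js jt z) z := by
  have := hasStrictFDerivAt_uncurry_coprod (𝕜 := ℝ) (u := z) (f := fun s (ξ : RN N) => j s ‖ξ‖)
    (f₁ := fun s ξ => js s ‖ξ‖ • ContinuousLinearMap.id ℝ ℝ)
    (f₂ := fun s ξ => innerSL ℝ (fluxVec jt (s, ξ)))
    (Eventually.of_forall fun v => by
      refine (hj.hasDeriv_s v.1 ‖v.2‖ (norm_nonneg _)).hasFDerivAt.congr_fderiv ?_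
      ext
      simp [Function.HasUncurry.uncurry])
    (Eventually.of_forall fun v => hj.hasFDerivAt_snd hp v.1 v.2)
    (hj.continuous_js.smul continuous_const).continuousAt
    ((innerSL ℝ).continuous.comp (hj.continuous_fluxVec hp)).continuousAt
  exact this.hasFDerivAt

theorem continuous_j (hj : AssumptionsJ N p j js jt) (hp : 1 < p) :
    Continuous fun z : ℝ × RN N => j z.1 ‖z.2‖ :=
  continuous_iff_continuousAt.2 fun z => (hj.hasFDerivAt hp z).continuousAt

theorem nonneg (hj : AssumptionsJ N p j js jt) (s : ℝ) (ξ : RN N) : 0 ≤ j s ‖ξ‖ := by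
  obtain ⟨α₀, h0, α, -, -, -, h⟩ := hj.growth
  exact le_trans (by positivity) (h s ξ).1

end AssumptionsJ

end PrincipalIntegrand

/-! ### Lower semicontinuity -/

section LowerSemicontinuity

variable {N : ℕ} {p : ℝ} [hp : Fact (1 < p)] {Ω : Set (RN N)} {j js jt f : ℝ → ℝ → ℝ}
  {g : ℝ → ℝ}

theorem aestronglyMeasurable_j (hj : AssumptionsJ N p j js jt) (u : W0 p Ω) :
    AEStronglyMeasurable (fun x => j (W0.val u x) ‖W0.grad u x‖) (volume.restrict Ω) :=
  (hj.continuous_j hp.out).comp_aestronglyMeasurable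
    ((W0.memLp_val u).1.prodMk (W0.memLp_grad u).1)

/-- Fatou's lemma for `J`, stated for the bounds of a sequence converging in norm. -/
theorem funcJ_le_of_tendsto (hj : AssumptionsJ N p j js jt) {w : ℕ → W0 p Ω} {u : W0 p Ω}
    (hw : Tendsto w atTop (𝓝 u)) {b : ℕ → ℝ≥0∞} {B : ℝ≥0∞} (hb : Tendsto b atTop (𝓝 B))
    (hle : ∀ n, funcJ j (w n) ≤ b n) : funcJ j u ≤ B := by
  obtain ⟨ns, hns, ae1, ae2⟩ := W0.exists_subseq_tendsto_ae hw
  have hlim : ∀ᵐ x ∂volume.restrict Ω,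
      liminf (fun n => ENNReal.ofReal (j (W0.val (w (ns n)) x) ‖W0.grad (w (ns n)) x‖)) atTop
        = ENNReal.ofReal (j (W0.val u x) ‖W0.grad u x‖) := by
    filter_upwards [ae1, ae2] with x h1 h2
    have := ((hj.continuous_j hp.out).tendsto (W0.val u x, W0.grad u x)).comp (h1.prodMk_nhds h2)
    exact (ENNReal.tendsto_ofReal this).liminf_eq
  calc funcJ j u = ∫⁻ x in Ω, liminf
        (fun n => ENNReal.ofReal (j (W0.val (w (ns n)) x) ‖W0.grad (w (ns n)) x‖)) atTop :=
        lintegral_congr_ae (hlim.mono fun x hx => hx.symm)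
    _ ≤ liminf (fun n => funcJ j (w (ns n))) atTop :=
        lintegral_liminf_le' fun n => (aestronglyMeasurable_j hj _).aemeasurable.ennreal_ofReal
    _ ≤ liminf (fun n => b (ns n)) atTop :=
        liminf_le_liminf (Eventually.of_forall fun n => hle _)
    _ = B := (hb.comp hns.tendsto_atTop).liminf_eq

theorem isClosed_constraintC (hg : AssumptionsG N p g) (hpN : p < N) :
    IsClosed (constraintC p Ω g) :=
  isClosed_eq (continuous_integral_primG hg hpN) continuous_const

theorem funcE_ne_bot (u : W0 p Ω) : funcE j f u ≠ ⊥ := by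
  rw [funcE, Ne, sub_eq_add_neg, EReal.add_eq_bot_iff, not_or, ← EReal.coe_neg]
  exact ⟨EReal.coe_ennreal_ne_bot _, EReal.coe_ne_bot _⟩

theorem funcE_le_coe_iff (u : W0 p Ω) (y : ℝ) :
    funcE j f u ≤ y ↔ 0 ≤ y + (∫ x in Ω, primF f ‖x‖ (W0.val u x)) ∧
      funcJ j u ≤ ENNReal.ofReal (y + ∫ x in Ω, primF f ‖x‖ (W0.val u x)) := by
  rw [funcE, EReal.sub_le_iff_le_add (Or.inl (EReal.coe_ne_bot _)) (Or.inl (EReal.coe_ne_top _)),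
    ← EReal.coe_add, ← EReal.coe_ennreal_le_coe_ennreal_iff, EReal.coe_ennreal_ofReal]
  constructor
  · intro h
    have h0 := (EReal.coe_ennreal_nonneg _).trans h
    exact ⟨EReal.coe_nonneg.1 h0, h.trans (EReal.coe_le_coe_iff.2 (le_max_left _ _))⟩
  · rintro ⟨h0, h⟩
    rwa [max_eq_left h0] at h

theorem lowerSemicontinuous_funcEStar (hpN : p < N) (hj : AssumptionsJ N p j js jt)
    (hf : AssumptionsF p Ω f) (hg : AssumptionsG N p g) :
    LowerSemicontinuous (funcEStar j f g : W0 p Ω → EReal) := by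
  intro u y hy
  by_contra hcon
  obtain ⟨w, hw, hwy⟩ := exists_seq_forall_of_frequently (not_eventually.1 hcon)
  have hmem : ∀ n, w n ∈ constraintC p Ω g := by
    intro n
    by_contra hn
    have htop : funcEStar j f g (w n) = ⊤ := if_neg hn
    refine hwy n (show y < _ from ?_)
    rw [htop]
    exact hy.trans_le le_top
  have hu : u ∈ constraintC p Ω g :=
    (isClosed_constraintC hg hpN).mem_of_tendsto hw (Eventually.of_forall hmem)
  rw [funcEStar, if_pos hu] at hy
  have hle : ∀ n, funcE j f (w n) ≤ y := by
    intro n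
    have := not_lt.1 (hwy n)
    rwa [funcEStar, if_pos (hmem n)] at this
  induction y with
  | bot => exact funcE_ne_bot _ (le_bot_iff.1 (hle 0))
  | top => exact not_top_lt hy
  | coe y =>
    have hIc := ((continuous_integral_primF hf hpN).tendsto u).comp hw
    have hle' := fun n => (funcE_le_coe_iff _ _).1 (hle n)
    refine not_le.2 hy ((funcE_le_coe_iff _ _).2
      ⟨ge_of_tendsto' (hIc.const_add y) fun n => (hle' n).1, ?_⟩)
    exact funcJ_le_of_tendsto hj hw (ENNReal.tendsto_ofReal (hIc.const_add y))
      fun n => (hle' n).2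

end LowerSemicontinuity

/-! ### A multiplier rule in two variables -/

/-- The Lagrange multiplier rule for functions of two variables which are differentiable at one
point only. The curve in the level set of `K` is replaced by points supplied by the intermediate
value theorem. -/
theorem mul_eq_mul_of_eventually_le_of_hasFDerivAt {e K : ℝ × ℝ → ℝ} {A A' B B' : ℝ}
    (he : HasFDerivAt e
      (A • ContinuousLinearMap.fst ℝ ℝ ℝ + A' • ContinuousLinearMap.snd ℝ ℝ ℝ) 0)
    (hK : HasFDerivAt K
      (B • ContinuousLinearMap.fst ℝ ℝ ℝ + B' • ContinuousLinearMap.snd ℝ ℝ ℝ) 0)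
    (hKc : Continuous K) (hB : B' ≠ 0) (hmin : ∀ᶠ z in 𝓝 0, K z = K 0 → e 0 ≤ e z) :
    A * B' = A' * B := by
  by_contra hne
  have hdne : A - A' * (B / B') ≠ 0 := by
    intro h
    apply hne
    field_simp at h
    linarith
  -- a direction `(σ, -σ B / B')` in the kernel of `K'` along which `e` decreases at rate `d`
  obtain ⟨σ, hσ, d, hd, hσd⟩ : ∃ σ : ℝ, |σ| = 1 ∧ ∃ d > 0, σ * (A - A' * (B / B')) = -d := by
    rcases lt_or_gt_of_ne hdne with h | h
    · exact ⟨1, by simp, -(A - A' * (B / B')), by linarith, by ring⟩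
    · exact ⟨-1, by simp, A - A' * (B / B'), h, by ring⟩
  set δ : ℝ := d / (2 * (|A'| + 1)) with hδ
  have hδ0 : 0 < δ := by positivity
  have hδA : δ * |A'| ≤ d / 2 := by
    rw [hδ, div_mul_eq_mul_div, div_le_div_iff₀ (by positivity) (by positivity)]
    nlinarith [abs_nonneg A']
  set M : ℝ := 1 + |B / B'| + δ with hM
  have hM0 : 0 < M := by positivity
  set P : ℝ → ℝ → ℝ × ℝ := fun t s => (t * σ, t * (-σ * (B / B') + s)) with hP
  have hPn : ∀ t s, 0 < t → |s| ≤ δ → ‖P t s‖ ≤ t * M := by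
    intro t s ht hs
    rw [hP, Prod.norm_def, Real.norm_eq_abs, Real.norm_eq_abs, abs_mul, abs_mul, abs_of_pos ht, hσ]
    refine max_le ?_ ?_
    · exact mul_le_mul_of_nonneg_left (by rw [hM]; linarith [abs_nonneg (B / B')]) ht.le
    · refine mul_le_mul_of_nonneg_left ((abs_add_le _ _).trans ?_) ht.le
      rw [abs_mul, abs_neg, hσ, hM]
      linarith
  set c : ℝ := min (d / 4) (δ * |B'| / 2) / M with hc
  have hB0 : 0 < |B'| := abs_pos.2 hB
  have hc0 : 0 < c := by positivity
  have hc1 : c * M ≤ d / 4 := by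
    rw [hc, div_mul_cancel₀ _ hM0.ne']
    exact min_le_left _ _
  have hc2 : c * M ≤ δ * |B'| / 2 := by
    rw [hc, div_mul_cancel₀ _ hM0.ne']
    exact min_le_right _ _
  rw [hasFDerivAt_iff_isLittleO_nhds_zero] at he hK
  have ev := (he.bound hc0).and ((hK.bound hc0).and hmin)
  obtain ⟨ρ, hρ, hball⟩ := Metric.eventually_nhds_iff_ball.1 ev
  obtain ⟨t, ht, htρ⟩ : ∃ t > 0, t * M < ρ := by
    refine ⟨ρ / (2 * M), by positivity, ?_⟩
    field_simp
    linarith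
  have hin : ∀ s, |s| ≤ δ → P t s ∈ Metric.ball (0 : ℝ × ℝ) ρ := fun s hs =>
    mem_ball_zero_iff.2 ((hPn t s ht hs).trans_lt htρ)
  have hKs : ∀ s, |s| ≤ δ → |K (P t s) - K 0 - t * s * B'| ≤ t * (δ * |B'| / 2) := by
    intro s hs
    have h1 := (hball _ (hin s hs)).2.1
    have h2 : (B • ContinuousLinearMap.fst ℝ ℝ ℝ + B' • ContinuousLinearMap.snd ℝ ℝ ℝ) (P t s)
        = t * s * B' := by
      simp [hP]
      field_simp
      ring
    rw [zero_add, h2, Real.norm_eq_abs] at h1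
    refine h1.trans ((mul_le_mul_of_nonneg_left (hPn t s ht hs) hc0.le).trans ?_)
    nlinarith
  have hes : ∀ s, |s| ≤ δ → e (P t s) < e 0 := by
    intro s hs
    have h1 := (hball _ (hin s hs)).1
    have h2 : (A • ContinuousLinearMap.fst ℝ ℝ ℝ + A' • ContinuousLinearMap.snd ℝ ℝ ℝ) (P t s)
        = t * (-d + s * A') := by
      rw [← hσd]
      simp [hP]
      ring
    rw [zero_add, h2, Real.norm_eq_abs] at h1
    have h3 : |e (P t s) - e 0 - t * (-d + s * A')| ≤ t * (d / 4) :=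
      h1.trans ((mul_le_mul_of_nonneg_left (hPn t s ht hs) hc0.le).trans (by nlinarith))
    have h4 : s * A' ≤ d / 2 := by
      refine (le_abs_self _).trans ?_
      rw [abs_mul]
      exact (mul_le_mul_of_nonneg_right hs (abs_nonneg _)).trans hδA
    have h5 := (abs_le.1 h3).2
    have h6 : t * (s * A') ≤ t * (d / 2) := mul_le_mul_of_nonneg_left h4 ht.le
    nlinarith [mul_pos ht hd]
  have hcont : Continuous fun s => K (P t s) := hKc.comp (by fun_prop)
  have hmem : K 0 ∈ uIcc (K (P t (-δ))) (K (P t δ)) := by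
    have k1 := abs_le.1 (hKs δ (abs_of_pos hδ0).le)
    have k2 := abs_le.1 (hKs (-δ) (by rw [abs_neg]; exact (abs_of_pos hδ0).le))
    have htδ := mul_pos ht (mul_pos hδ0 hB0)
    rw [mem_uIcc]
    rcases lt_or_gt_of_ne hB with h | h
    · rw [abs_of_neg h] at k1 k2 htδ
      exact Or.inr ⟨by nlinarith, by nlinarith⟩
    · rw [abs_of_pos h] at k1 k2 htδ
      exact Or.inl ⟨by nlinarith, by nlinarith⟩
  obtain ⟨s, hs, hKs0⟩ := intermediate_value_uIcc hcont.continuousOn hmem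
  have hs' : |s| ≤ δ := by
    rw [uIcc_of_le (by linarith)] at hs
    exact abs_le.2 hs
  exact absurd ((hball _ (hin s hs')).2.2 hKs0) (not_le.2 (hes s hs'))

/-! ### Differentiability of the principal term along `V_u` -/

section Differentiability

variable {N : ℕ} {p : ℝ} {j js jt : ℝ → ℝ → ℝ}

/-- The growth conditions, uniformly for bounded `s`. -/
theorem AssumptionsJ.exists_bound (hj : AssumptionsJ N p j js jt) {R : ℝ} (hR : 0 ≤ R) :
    ∃ K ≥ 0, ∀ (s : ℝ) (ξ : RN N), |s| ≤ R → j s ‖ξ‖ ≤ K * ‖ξ‖ ^ p ∧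
      |js s ‖ξ‖| ≤ K * ‖ξ‖ ^ p ∧ |jt s ‖ξ‖| ≤ K * ‖ξ‖ ^ (p - 1) := by
  obtain ⟨α₀, -, α, -, αm, α0, hα⟩ := hj.growth
  obtain ⟨β, -, βm, β0, hβ⟩ := hj.growth_s
  obtain ⟨γ, -, γm, γ0, hγ⟩ := hj.growth_t
  have a0 := α0 R hR
  have b0 := β0 R hR
  have c0 := γ0 R hR
  refine ⟨α R + β R + γ R, by positivity, fun s ξ hs => ?_⟩
  have a1 := αm (abs_nonneg s) hR hs
  have b1 := βm (abs_nonneg s) hR hs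
  have c1 := γm (abs_nonneg s) hR hs
  exact ⟨(hα s ξ).2.trans (by gcongr; linarith), (hβ s ξ).trans (by gcongr; linarith),
    (hγ s ξ).trans (by gcongr; linarith)⟩

/-- The bound on the derivatives of `(s, ξ) ↦ j(s, |ξ|)` in directions whose components are
controlled by `M` and by a common majorant `T` of all gradients. -/
theorem AssumptionsJ.exists_directional_bound (hj : AssumptionsJ N p j js jt) (hp : 1 < p)
    {R M : ℝ} (hR : 0 ≤ R) (hM : 0 ≤ M) :
    ∃ K ≥ 0, ∀ (y : ℝ × RN N) (T : ℝ), |y.1| ≤ R → ‖y.2‖ ≤ T → j y.1 ‖y.2‖ ≤ K * T ^ p ∧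
      ∀ (s : ℝ) (ξ : RN N), |s| ≤ M → ‖ξ‖ ≤ T →
        |js y.1 ‖y.2‖ * s| + ‖fluxVec jt y‖ * ‖ξ‖ ≤ K * T ^ p := by
  obtain ⟨K, hK0, hK⟩ := hj.exists_bound hR
  refine ⟨K * (M + 1), by positivity, fun y T hy1 hy2 => ?_⟩
  have hT0 : 0 ≤ T := (norm_nonneg _).trans hy2
  obtain ⟨kj, ks, kt⟩ := hK y.1 y.2 hy1
  have hpow : ‖y.2‖ ^ p ≤ T ^ p := by gcongr
  have hpow' : ‖y.2‖ ^ (p - 1) ≤ T ^ (p - 1) :=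
    Real.rpow_le_rpow (norm_nonneg _) hy2 (by linarith)
  have hTT : T ^ (p - 1) * T = T ^ p := by
    have := Real.rpow_add' hT0 (y := p - 1) (z := 1) (by linarith)
    rw [Real.rpow_one, sub_add_cancel] at this
    exact this.symm
  have hTp : 0 ≤ T ^ p := Real.rpow_nonneg hT0 _
  have hTp' : 0 ≤ T ^ (p - 1) := Real.rpow_nonneg hT0 _
  have hKp : K * ‖y.2‖ ^ p ≤ K * T ^ p := mul_le_mul_of_nonneg_left hpow hK0
  have hKp' : K * ‖y.2‖ ^ (p - 1) ≤ K * T ^ (p - 1) := mul_le_mul_of_nonneg_left hpow' hK0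
  have e : K * (M + 1) * T ^ p = K * T ^ p * M + K * T ^ p := by ring
  rw [e]
  refine ⟨(kj.trans hKp).trans (le_add_of_nonneg_left (by positivity)), fun s ξ hs hξ =>
    add_le_add ?_ ?_⟩
  · rw [abs_mul]
    exact mul_le_mul (ks.trans hKp) hs (abs_nonneg _) (by positivity)
  · rw [← hTT, ← mul_assoc]
    exact mul_le_mul ((norm_fluxVec_le y).trans (kt.trans hKp')) hξ (norm_nonneg _)
      (by positivity)

variable [hp : Fact (1 < p)] {Ω : Set (RN N)}

/-- The pair `(u, Du)`, as a function on `ℝ^N`. -/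
noncomputable def W0.pair (u : W0 p Ω) (x : RN N) : ℝ × RN N := (W0.val u x, W0.grad u x)

theorem W0.pair_add_smul_add_smul (u v w : W0 p Ω) (a b : ℝ) :
    W0.pair (u + a • v + b • w) =ᵐ[volume.restrict Ω]
      fun x => W0.pair u x + a • W0.pair v x + b • W0.pair w x := by
  filter_upwards [W0.val_add (u + a • v) (b • w), W0.grad_add (u + a • v) (b • w),
    W0.val_add u (a • v), W0.grad_add u (a • v), W0.val_smul a v, W0.grad_smul a v,
    W0.val_smul b w, W0.grad_smul b w] with x h1 h2 h3 h4 h5 h6 h7 h8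
  simp [W0.pair, h1, h2, h3, h4, h5, h6, h7, h8]

/-- The key domination: near `u` in the plane spanned by two elements of `V_u`, the integrand of `J`
and of its directional derivatives are bounded by integrable functions. Off the set where `φ` or
`ψ` is nonzero nothing varies, because there `Dφ` and `Dψ` vanish; on that set `u` is bounded. -/
theorem exists_integrable_bound (hj : AssumptionsJ N p j js jt) (hΩ : IsOpen Ω) {u φ ψ : W0 p Ω}
    (hφ : φ ∈ testSpaceV u) (hψ : ψ ∈ testSpaceV u) :
    ∃ bd : RN N → ℝ, IntegrableOn bd Ω ∧ ∀ᵐ x ∂volume.restrict Ω,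
      ∀ z ∈ Metric.ball (0 : ℝ × ℝ) 1, ∀ y,
        y = W0.pair u x + z.1 • W0.pair φ x + z.2 • W0.pair ψ x →
        |js y.1 ‖y.2‖ * W0.val φ x| + ‖fluxVec jt y‖ * ‖W0.grad φ x‖ ≤ bd x ∧
        |js y.1 ‖y.2‖ * W0.val ψ x| + ‖fluxVec jt y‖ * ‖W0.grad ψ x‖ ≤ bd x ∧
        j y.1 ‖y.2‖ ≤ j (W0.val u x) ‖W0.grad u x‖ + bd x := by
  have hp1 := hp.out
  obtain ⟨⟨M1, h1⟩, M2, h2⟩ := hφ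
  obtain ⟨⟨M3, h3⟩, M4, h4⟩ := hψ
  set M : ℝ := |M1| + |M2| + |M3| + |M4| with hM
  have hM0 : 0 ≤ M := by positivity
  have le1 : M1 ≤ M := by linarith [le_abs_self M1, abs_nonneg M2, abs_nonneg M3, abs_nonneg M4]
  have le2 : M2 ≤ M := by linarith [le_abs_self M2, abs_nonneg M1, abs_nonneg M3, abs_nonneg M4]
  have le3 : M3 ≤ M := by linarith [le_abs_self M3, abs_nonneg M2, abs_nonneg M1, abs_nonneg M4]
  have le4 : M4 ≤ M := by linarith [le_abs_self M4, abs_nonneg M2, abs_nonneg M3, abs_nonneg M1]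
  obtain ⟨K, hK0, hK⟩ := hj.exists_directional_bound hp1 (R := 3 * M) (by positivity) hM0
  set T : RN N → ℝ := fun x => ‖W0.grad u x‖ + ‖W0.grad φ x‖ + ‖W0.grad ψ x‖ with hT
  have T0 : ∀ x, 0 ≤ T x := fun x => by positivity
  have hTm : MemLp T (ENNReal.ofReal p) (volume.restrict Ω) :=
    ((W0.memLp_grad u).norm.add (W0.memLp_grad φ).norm).add (W0.memLp_grad ψ).norm
  have hTi : Integrable (fun x => T x ^ p) (volume.restrict Ω) := by
    have := hTm.integrable_norm_rpow (by simp; linarith) (by simp)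
    rw [ENNReal.toReal_ofReal (by linarith)] at this
    refine this.congr (Eventually.of_forall fun x => ?_)
    simp only [Real.norm_eq_abs, abs_of_nonneg (T0 x)]
  refine ⟨fun x => K * T x ^ p, hTi.const_mul _, ?_⟩
  filter_upwards [h1, h2, h3, h4, W0.grad_eq_zero_of_val_eq_zero hΩ φ,
    W0.grad_eq_zero_of_val_eq_zero hΩ ψ] with x a1 a2 a3 a4 g1 g2 z hz y hy
  have bd0 : 0 ≤ K * T x ^ p := by have := T0 x; positivity
  by_cases h0 : W0.val φ x = 0 ∧ W0.val ψ x = 0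
  · have e1 := g1 h0.1
    have e2 := g2 h0.2
    have ey : y = W0.pair u x := by
      rw [hy]
      simp [W0.pair, h0.1, h0.2, e1, e2]
    rw [ey, h0.1, h0.2, e1, e2]
    refine ⟨by simpa using bd0, by simpa using bd0, ?_⟩
    simpa [W0.pair] using bd0
  · have hu : |W0.val u x| ≤ M := by
      by_cases hφ0 : W0.val φ x = 0
      · exact (a4 fun h => h0 ⟨hφ0, h⟩).trans le4
      · exact (a2 hφ0).trans le2
    have b1 : |W0.val φ x| ≤ M := a1.trans le1
    have b3 : |W0.val ψ x| ≤ M := a3.trans le3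
    have hz1 : |z.1| ≤ 1 := (norm_fst_le z).trans (mem_ball_zero_iff.1 hz).le
    have hz2 : |z.2| ≤ 1 := (norm_snd_le z).trans (mem_ball_zero_iff.1 hz).le
    have hy1 : |y.1| ≤ 3 * M := by
      rw [hy]
      simp only [W0.pair, Prod.fst_add, Prod.smul_fst, smul_eq_mul]
      refine (abs_add_three _ _ _).trans ?_
      rw [abs_mul, abs_mul]
      have := mul_le_mul hz1 b1 (abs_nonneg _) zero_le_one
      have := mul_le_mul hz2 b3 (abs_nonneg _) zero_le_one
      linarith
    have hy2 : ‖y.2‖ ≤ T x := by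
      rw [hy]
      simp only [W0.pair, Prod.snd_add, Prod.smul_snd]
      refine norm_add₃_le.trans ?_
      rw [norm_smul, norm_smul, Real.norm_eq_abs, Real.norm_eq_abs]
      have := mul_le_of_le_one_left (norm_nonneg (W0.grad φ x)) hz1
      have := mul_le_of_le_one_left (norm_nonneg (W0.grad ψ x)) hz2
      simp only [hT]
      linarith
    obtain ⟨kj, main⟩ := hK y (T x) hy1 hy2
    refine ⟨main _ _ b1 ?_, main _ _ b3 ?_, ?_⟩
    · simp only [hT]
      linarith [norm_nonneg (W0.grad u x), norm_nonneg (W0.grad ψ x)]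
    · simp only [hT]
      linarith [norm_nonneg (W0.grad u x), norm_nonneg (W0.grad φ x)]
    · exact kj.trans (le_add_of_nonneg_left (hj.nonneg (W0.val u x) (W0.grad u x)))

theorem aestronglyMeasurable_pair (u : W0 p Ω) :
    AEStronglyMeasurable (W0.pair u) (volume.restrict Ω) :=
  (W0.memLp_val u).1.prodMk (W0.memLp_grad u).1

theorem fluxTerm_eq_inner (u φ : W0 p Ω) (x : RN N) :
    fluxTerm jt u φ x = inner ℝ (fluxVec jt (W0.pair u x)) (W0.grad φ x) := by
  simp only [fluxTerm, fluxVec, W0.pair]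
  exact (real_inner_smul_left _ _ _).symm

theorem differentialJ_pair (u φ : W0 p Ω) (x : RN N) :
    differentialJ js jt (W0.pair u x) (W0.pair φ x)
      = js (W0.val u x) ‖W0.grad u x‖ * W0.val φ x + fluxTerm jt u φ x := by
  rw [differentialJ_apply, fluxTerm_eq_inner]
  rfl

theorem integrableOn_js_mul_and_fluxTerm (hj : AssumptionsJ N p j js jt) (hΩ : IsOpen Ω)
    {u φ : W0 p Ω} (hφ : φ ∈ testSpaceV u) :
    IntegrableOn (fun x => js (W0.val u x) ‖W0.grad u x‖ * W0.val φ x) Ω ∧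
      IntegrableOn (fluxTerm jt u φ) Ω := by
  obtain ⟨bd, hbd, hb⟩ := exists_integrable_bound hj hΩ hφ hφ
  have hb0 : ∀ᵐ x ∂volume.restrict Ω, |js (W0.val u x) ‖W0.grad u x‖ * W0.val φ x|
      + ‖fluxVec jt (W0.pair u x)‖ * ‖W0.grad φ x‖ ≤ bd x := by
    filter_upwards [hb] with x hx
    exact (hx 0 (by simp) (W0.pair u x) (by simp)).1
  constructor
  · refine Integrable.mono' hbd ((hj.continuous_js.comp_aestronglyMeasurable
      (aestronglyMeasurable_pair u)).mul (W0.memLp_val φ).1) ?_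
    filter_upwards [hb0] with x hx
    rw [Real.norm_eq_abs]
    exact le_trans (le_add_of_nonneg_right (by positivity)) hx
  · simp only [IntegrableOn, funext (fluxTerm_eq_inner (jt := jt) u φ)]
    refine Integrable.mono' hbd (((hj.continuous_fluxVec hp.out).comp_aestronglyMeasurable
      (aestronglyMeasurable_pair u)).inner (W0.memLp_grad φ).1) ?_
    filter_upwards [hb0] with x hx
    exact (norm_inner_le_norm _ _).trans (le_trans (le_add_of_nonneg_left (abs_nonneg _)) hx)

theorem integrableOn_j_of_mem_ball (hj : AssumptionsJ N p j js jt) (hΩ : IsOpen Ω)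
    {u φ ψ : W0 p Ω} (hφ : φ ∈ testSpaceV u) (hψ : ψ ∈ testSpaceV u)
    (hu : IntegrableOn (fun x => j (W0.val u x) ‖W0.grad u x‖) Ω)
    {z : ℝ × ℝ} (hz : z ∈ Metric.ball (0 : ℝ × ℝ) 1) : IntegrableOn (fun x =>
      j (W0.val (u + z.1 • φ + z.2 • ψ) x) ‖W0.grad (u + z.1 • φ + z.2 • ψ) x‖) Ω := by
  obtain ⟨bd, hbd, hb⟩ := exists_integrable_bound hj hΩ hφ hψ
  refine Integrable.mono' (hu.add hbd) (aestronglyMeasurable_j hj _) ?_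
  filter_upwards [hb, W0.pair_add_smul_add_smul u φ ψ z.1 z.2] with x hx hxz
  rw [Real.norm_eq_abs, abs_of_nonneg (hj.nonneg _ _)]
  exact (hx z hz _ hxz).2.2

theorem abs_differentialJ_pair_le (y : ℝ × RN N) (v : W0 p Ω) (x : RN N) :
    |differentialJ js jt y (W0.pair v x)|
      ≤ |js y.1 ‖y.2‖ * W0.val v x| + ‖fluxVec jt y‖ * ‖W0.grad v x‖ := by
  rw [differentialJ_apply]
  exact (abs_add_le _ _).trans (add_le_add le_rfl (abs_real_inner_le_norm _ _))

theorem integrable_differentialJ_pair (hj : AssumptionsJ N p j js jt) (hΩ : IsOpen Ω)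
    {u φ : W0 p Ω} (hφ : φ ∈ testSpaceV u) :
    IntegrableOn (fun x => differentialJ js jt (W0.pair u x) (W0.pair φ x)) Ω ∧
      ∫ x in Ω, differentialJ js jt (W0.pair u x) (W0.pair φ x)
        = (∫ x in Ω, fluxTerm jt u φ x)
          + ∫ x in Ω, js (W0.val u x) ‖W0.grad u x‖ * W0.val φ x := by
  obtain ⟨i1, i2⟩ := integrableOn_js_mul_and_fluxTerm hj hΩ hφ
  simp only [differentialJ_pair]
  refine ⟨i1.add i2, ?_⟩
  rw [integral_add i1 i2, add_comm]

theorem integral_j_plane_eq (u φ ψ : W0 p Ω) (z : ℝ × ℝ) :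
    ∫ x in Ω, j (W0.val (u + z.1 • φ + z.2 • ψ) x) ‖W0.grad (u + z.1 • φ + z.2 • ψ) x‖
      = ∫ x in Ω, j (W0.pair u x + z.1 • W0.pair φ x + z.2 • W0.pair ψ x).1
        ‖(W0.pair u x + z.1 • W0.pair φ x + z.2 • W0.pair ψ x).2‖ := by
  refine integral_congr_ae ?_
  filter_upwards [W0.pair_add_smul_add_smul u φ ψ z.1 z.2] with x hx
  rw [← hx]
  rfl

/-- `J` is differentiable at `u` in the plane spanned by two elements of `V_u`. -/
theorem hasFDerivAt_integral_j (hj : AssumptionsJ N p j js jt) (hΩ : IsOpen Ω)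
    {u φ ψ : W0 p Ω} (hφ : φ ∈ testSpaceV u) (hψ : ψ ∈ testSpaceV u)
    (hu : IntegrableOn (fun x => j (W0.val u x) ‖W0.grad u x‖) Ω) :
    HasFDerivAt (fun z : ℝ × ℝ => ∫ x in Ω,
        j (W0.val (u + z.1 • φ + z.2 • ψ) x) ‖W0.grad (u + z.1 • φ + z.2 • ψ) x‖)
      (((∫ x in Ω, fluxTerm jt u φ x)
          + ∫ x in Ω, js (W0.val u x) ‖W0.grad u x‖ * W0.val φ x) • ContinuousLinearMap.fst ℝ ℝ ℝ
        + ((∫ x in Ω, fluxTerm jt u ψ x)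
          + ∫ x in Ω, js (W0.val u x) ‖W0.grad u x‖ * W0.val ψ x) •
            ContinuousLinearMap.snd ℝ ℝ ℝ) 0 := by
  obtain ⟨bd, hbd, hb⟩ := exists_integrable_bound hj hΩ hφ hψ
  have Iφ := integrable_differentialJ_pair hj hΩ hφ
  have Iψ := integrable_differentialJ_pair hj hΩ hψ
  simp only [integral_j_plane_eq]
  rw [← Iφ.2, ← Iψ.2]
  have hbound : ∀ᵐ x ∂volume.restrict Ω, ∀ z ∈ Metric.ball (0 : ℝ × ℝ) 1,
      |differentialJ js jt (W0.pair u x + z.1 • W0.pair φ x + z.2 • W0.pair ψ x) (W0.pair φ x)|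
        + |differentialJ js jt (W0.pair u x + z.1 • W0.pair φ x + z.2 • W0.pair ψ x) (W0.pair ψ x)|
        ≤ bd x + bd x := by
    filter_upwards [hb] with x hx z hz
    obtain ⟨q1, q2, -⟩ := hx z hz _ rfl
    exact add_le_add ((abs_differentialJ_pair_le _ _ _).trans q1)
      ((abs_differentialJ_pair_le _ _ _).trans q2)
  have hmeas : ∀ z : ℝ × ℝ, AEStronglyMeasurable (fun x =>
      (fun y : ℝ × RN N => j y.1 ‖y.2‖) (W0.pair u x + z.1 • W0.pair φ x + z.2 • W0.pair ψ x))
      (volume.restrict Ω) := fun z =>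
    (hj.continuous_j hp.out).comp_aestronglyMeasurable
      (((aestronglyMeasurable_pair u).add ((aestronglyMeasurable_pair φ).const_smul z.1)).add
        ((aestronglyMeasurable_pair ψ).const_smul z.2))
  have hd : ∀ᵐ x ∂volume.restrict Ω, ∀ v : ℝ × RN N,
      HasFDerivAt (fun y : ℝ × RN N => j y.1 ‖y.2‖) (differentialJ js jt v) v :=
    Eventually.of_forall fun _ v => hj.hasFDerivAt hp.out v
  have key := hasFDerivAt_integral_comp_plane (μ := volume.restrict Ω)
    (H := fun _ (y : ℝ × RN N) => j y.1 ‖y.2‖) (H' := fun _ y => differentialJ js jt y)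
    (a := W0.pair u) (b := W0.pair φ) (c := W0.pair ψ) (bound := fun x => bd x + bd x)
    hmeas hu Iφ.1.1 Iψ.1.1 hd hbound (hbd.add hbd)
  exact key.2.2

theorem NemytskiiGrowth.hasFDerivAt_integral_plane {h : RN N → ℝ → ℝ}
    (H : NemytskiiGrowth p (sobolevExp N p) (volume.restrict Ω) h) (hpN : p < N)
    (u φ ψ : W0 p Ω) :
    HasFDerivAt (fun z : ℝ × ℝ =>
        ∫ x in Ω, ∫ τ in (0 : ℝ)..W0.val (u + z.1 • φ + z.2 • ψ) x, h x τ)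
      ((∫ x in Ω, h x (W0.val u x) * W0.val φ x) • ContinuousLinearMap.fst ℝ ℝ ℝ
        + (∫ x in Ω, h x (W0.val u x) * W0.val ψ x) • ContinuousLinearMap.snd ℝ ℝ ℝ) 0 := by
  have key := H.hasFDerivAt_integral_primitive hp.out (one_lt_sobolevExp hp.out hpN)
    (W0.memLp_val u) (W0.memLp_val_sobolevExp hpN u) (W0.memLp_val φ)
    (W0.memLp_val_sobolevExp hpN φ) (W0.memLp_val ψ) (W0.memLp_val_sobolevExp hpN ψ)
  refine key.congr_of_eventuallyEq (Eventually.of_forall fun z => integral_congr_ae ?_)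
  filter_upwards [W0.pair_add_smul_add_smul u φ ψ z.1 z.2] with x hx
  have := congrArg Prod.fst hx
  simp only [W0.pair, Prod.fst_add, Prod.smul_fst] at this
  rw [this]

end Differentiability

/-! ### The Lagrange multiplier -/

section Multiplier

variable {N : ℕ} {p : ℝ}

theorem AssumptionsG.apply_zero {g : ℝ → ℝ} (hg : AssumptionsG N p g) (hp : 1 < p) (hpN : p < N) :
    g 0 = 0 := by
  obtain ⟨C, -, h⟩ := hg.growth
  have hs := one_lt_sobolevExp hp hpN
  have := h 0
  rw [abs_zero, Real.zero_rpow (by linarith), Real.zero_rpow (by linarith), mul_zero,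
    add_zero] at this
  exact abs_nonpos_iff.1 this

variable [hp : Fact (1 < p)] {Ω : Set (RN N)} {j js jt f : ℝ → ℝ → ℝ} {g : ℝ → ℝ}

/-- If `g(u) = 0` a.e., then `G(u) = 0` a.e.: with a smooth `k ≥ 0` whose support is `{g ≠ 0}` and
`h(s) = ∫_0^s k`, the gradient of `h(u)` is `k(u) Du = 0`, so that `h(u) = 0` and hence `g`
vanishes between `0` and the values of `u`. -/
theorem primG_ae_eq_zero (hpN : p < N) (hg : Continuous g) {u : W0 p Ω}
    (hu : ∀ᵐ x ∂volume.restrict Ω, g (W0.val u x) = 0) :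
    ∀ᵐ x ∂volume.restrict Ω, primG g (W0.val u x) = 0 := by
  obtain ⟨k, hk, hks, hkr⟩ := (isOpen_ne_fun hg (continuous_const (y := (0 : ℝ)))
    ).exists_contDiff_support_eq (n := ⊤)
  have hk01 : ∀ s, 0 ≤ k s ∧ k s ≤ 1 := fun s => hkr (mem_range_self s)
  have hkg : ∀ s, k s = 0 → g s = 0 := by
    intro s hs
    by_contra hgs
    have : s ∈ Function.support k := by rw [hk]; exact hgs
    exact this hs
  have hgk : ∀ s, g s = 0 → k s = 0 := by
    intro s hs
    by_contra h
    have : s ∈ Function.support k := h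
    rw [hk] at this
    exact this hs
  have hkc : Continuous k := hks.continuous
  have hder : ∀ s, HasDerivAt (fun s => ∫ τ in (0 : ℝ)..s, k τ) (k s) s := fun s =>
    intervalIntegral.integral_hasDerivAt_right (hkc.intervalIntegrable 0 s)
      (hkc.stronglyMeasurableAtFilter _ _) hkc.continuousAt
  have hd : deriv (fun s => ∫ τ in (0 : ℝ)..s, k τ) = k := funext fun s => (hder s).deriv
  have hsm : ContDiff ℝ ∞ (fun s => ∫ τ in (0 : ℝ)..s, k τ) := by
    rw [contDiff_infty_iff_deriv, hd]
    exact ⟨fun s => (hder s).differentiableAt, hks⟩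
  obtain ⟨w, w1, w2⟩ := W0.exists_comp u hsm (by simp) (L := 1) (fun s => by
    rw [hd, abs_of_nonneg (hk01 s).1]
    exact (hk01 s).2)
  have hgrad : W0.grad w =ᵐ[volume.restrict Ω] 0 := by
    filter_upwards [w2, hu] with x h1 h2
    rw [h1, hd, hgk _ h2]
    simp
  have hval := W0.val_ae_eq_zero_of_grad_ae_eq_zero hpN hgrad
  filter_upwards [w1, hval] with x h1 h2
  rw [h2] at h1
  have h3 := (intervalIntegral.integral_eq_zero_iff_of_nonneg_ae
    (Eventually.of_forall fun s => (hk01 s).1) (hkc.intervalIntegrable 0 (W0.val u x))).1 h1.symm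
  refine intervalIntegral.integral_zero_ae ?_
  have h4 := (ae_restrict_iff' (measurableSet_Ioc.union measurableSet_Ioc)).1 h3
  filter_upwards [h4] with s hs hmem
  refine hkg s (hs ?_)
  rwa [uIoc_eq_union] at hmem

/-- On the constraint, some `φ ∈ V_u` detects the derivative of the constraint. It is found in the
form `η(u)`, with `η` a bump function supported where `g` has constant sign. -/
theorem exists_mem_testSpaceV_integral_ne_zero (hpN : p < N) (hg : AssumptionsG N p g)
    {u : W0 p Ω} (hu : u ∈ constraintC p Ω g) :
    ∃ φ ∈ testSpaceV u, ∫ x in Ω, g (W0.val u x) * W0.val φ x ≠ 0 := by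
  have hp1 := hp.out
  have hum : AEMeasurable (W0.val u) (volume.restrict Ω) := (W0.memLp_val u).1.aemeasurable
  set S : Set ℝ := {s | g s ≠ 0} with hS
  have hSo : IsOpen S := isOpen_ne_fun hg.continuous continuous_const
  have hpos : (volume.restrict Ω).map (W0.val u) S ≠ 0 := by
    intro h0
    rw [Measure.map_apply_of_aemeasurable hum hSo.measurableSet] at h0
    have hu0 : ∀ᵐ x ∂volume.restrict Ω, g (W0.val u x) = 0 := by
      rw [ae_iff]
      exact h0
    have := primG_ae_eq_zero hpN hg.continuous hu0
    have h1 : ∫ x in Ω, primG g (W0.val u x) = 1 := hu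
    rw [integral_eq_zero_of_ae this] at h1
    exact zero_ne_one h1
  obtain ⟨s₀, hs₀, hnhds⟩ := exists_mem_forall_mem_nhdsWithin_pos_measure hpos
  have hg0 := hg.apply_zero hp1 hpN
  have hs₀0 : s₀ ≠ 0 := by
    rintro rfl
    exact hs₀ hg0
  have hev : ∀ᶠ s in 𝓝 s₀, 0 < g s₀ * g s ∧ s ≠ 0 := by
    refine Filter.Eventually.and ?_ (isOpen_ne.mem_nhds hs₀0)
    have : Tendsto (fun s => g s₀ * g s) (𝓝 s₀) (𝓝 (g s₀ * g s₀)) :=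
      (continuous_const.mul hg.continuous).tendsto s₀
    exact this.eventually (lt_mem_nhds (mul_self_pos.2 hs₀))
  obtain ⟨ε, hε, hball⟩ := Metric.eventually_nhds_iff_ball.1 hev
  let η : ContDiffBump s₀ := ⟨ε / 2, ε, by linarith, by linarith⟩
  have hηs : ∀ s, η s ≠ 0 ↔ s ∈ Metric.ball s₀ ε := by
    intro s
    have := η.support_eq
    rw [Set.ext_iff] at this
    exact this s
  have hη0 : η 0 = 0 := by
    by_contra h
    exact (hball 0 ((hηs 0).1 h)).2 rfl
  have hηd : Continuous (deriv η) := (η.contDiff (n := ⊤)).continuous_deriv (by simp)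
  obtain ⟨L, hL⟩ := η.hasCompactSupport.deriv.exists_bound_of_continuous hηd
  obtain ⟨φ, hφ, -⟩ := W0.exists_comp u (η.contDiff (n := ⊤)) hη0 hL
  refine ⟨φ, ⟨⟨1, ?_⟩, |s₀| + ε, ?_⟩, ?_⟩
  · filter_upwards [hφ] with x hx
    rw [hx, abs_of_nonneg η.nonneg]
    exact η.le_one
  · filter_upwards [hφ] with x hx h0
    rw [hx] at h0
    have h1 := (hηs _).1 h0
    rw [Metric.mem_ball, Real.dist_eq] at h1
    have := abs_add_le (W0.val u x - s₀) s₀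
    rw [sub_add_cancel] at this
    linarith
  · have hi : IntegrableOn (fun x => g (W0.val u x) * W0.val φ x) Ω :=
      hg.nemytskiiGrowth.integrable_mul hp1 (one_lt_sobolevExp hp1 hpN) (W0.memLp_val u)
        (W0.memLp_val_sobolevExp hpN u) (W0.memLp_val φ) (W0.memLp_val_sobolevExp hpN φ)
    have hprod : ∀ s, 0 ≤ g s₀ * (g s * η s) ∧
        (s ∈ Metric.ball s₀ ε → g s₀ * (g s * η s) ≠ 0) := by
      intro s
      by_cases hs : s ∈ Metric.ball s₀ ε
      · have h1 : 0 < η s := lt_of_le_of_ne η.nonneg (Ne.symm ((hηs s).2 hs))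
        have h2 := mul_pos (hball s hs).1 h1
        rw [mul_assoc] at h2
        exact ⟨h2.le, fun _ => h2.ne'⟩
      · have : η s = 0 := by
          by_contra h
          exact hs ((hηs s).1 h)
        exact ⟨by simp [this], fun h => absurd h hs⟩
    have hlt : 0 < ∫ x in Ω, g s₀ * (g (W0.val u x) * W0.val φ x) := by
      rw [integral_pos_iff_support_of_nonneg_ae ?_ (hi.const_mul _)]
      · have hb := hnhds (Metric.ball s₀ ε)
          (mem_nhdsWithin_of_mem_nhds (Metric.ball_mem_nhds s₀ hε))
        rw [Measure.map_apply_of_aemeasurable hum Metric.isOpen_ball.measurableSet] at hb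
        refine hb.trans_le (measure_mono_ae ?_)
        filter_upwards [hφ] with x hx hmem
        have := (hprod (W0.val u x)).2 hmem
        rw [← hx] at this
        exact this
      · filter_upwards [hφ] with x hx
        rw [hx]
        exact (hprod _).1
    rw [integral_const_mul] at hlt
    intro h
    rw [h, mul_zero] at hlt
    exact lt_irrefl _ hlt

theorem funcE_eq_coe (hj : AssumptionsJ N p j js jt) {u : W0 p Ω}
    (hu : IntegrableOn (fun x => j (W0.val u x) ‖W0.grad u x‖) Ω) :
    funcE j f u = (((∫ x in Ω, j (W0.val u x) ‖W0.grad u x‖)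
      - ∫ x in Ω, primF f ‖x‖ (W0.val u x) : ℝ) : EReal) := by
  have h0 : 0 ≤ ∫ x in Ω, j (W0.val u x) ‖W0.grad u x‖ :=
    integral_nonneg fun x => hj.nonneg _ _
  rw [funcE, funcJ, ← ofReal_integral_eq_lintegral_ofReal hu
    (Eventually.of_forall fun x => hj.nonneg _ _), EReal.coe_ennreal_ofReal, max_eq_left h0,
    EReal.coe_sub]

theorem integrableOn_of_funcE_ne_top (hj : AssumptionsJ N p j js jt) {u : W0 p Ω}
    (hu : funcE j f u ≠ ⊤) : IntegrableOn (fun x => j (W0.val u x) ‖W0.grad u x‖) Ω := by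
  have hJ : funcJ j u ≠ ⊤ := by
    intro h
    rw [funcE, h, EReal.coe_ennreal_top, EReal.top_sub_coe] at hu
    exact hu rfl
  refine ⟨aestronglyMeasurable_j hj u, ?_⟩
  rw [hasFiniteIntegral_iff_ofReal (Eventually.of_forall fun x => hj.nonneg _ _)]
  exact lt_top_iff_ne_top.2 hJ

/-- The derivatives at a minimizer `u` of the functional and of the constraint are proportional on
any two elements of `V_u`, if the second one is not tangent to the constraint. -/
theorem IsSolution.mul_eq_mul (hpN : p < N) (hΩ : IsOpen Ω) (hj : AssumptionsJ N p j js jt)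
    (hf : AssumptionsF p Ω f) (hg : AssumptionsG N p g) {u : W0 p Ω} (hu : IsSolution j f g u)
    {φ ψ : W0 p Ω} (hφ : φ ∈ testSpaceV u) (hψ : ψ ∈ testSpaceV u)
    (hne : ∫ x in Ω, g (W0.val u x) * W0.val ψ x ≠ 0) :
    ((∫ x in Ω, fluxTerm jt u φ x) + (∫ x in Ω, js (W0.val u x) ‖W0.grad u x‖ * W0.val φ x)
        - ∫ x in Ω, f ‖x‖ (W0.val u x) * W0.val φ x) * (∫ x in Ω, g (W0.val u x) * W0.val ψ x)
      = ((∫ x in Ω, fluxTerm jt u ψ x) + (∫ x in Ω, js (W0.val u x) ‖W0.grad u x‖ * W0.val ψ x)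
        - ∫ x in Ω, f ‖x‖ (W0.val u x) * W0.val ψ x)
          * ∫ x in Ω, g (W0.val u x) * W0.val φ x := by
  have hfin : funcE j f u ≠ ⊤ := by
    rw [hu.eq]
    exact hu.lt_top.ne
  have hint := integrableOn_of_funcE_ne_top hj hfin
  have hJd := hasFDerivAt_integral_j hj hΩ hφ hψ hint
  have hFd := (hf.nemytskiiGrowth hpN).hasFDerivAt_integral_plane hpN u φ ψ
  have hGd := (hg.nemytskiiGrowth (Ω := Ω)).hasFDerivAt_integral_plane hpN u φ ψ
  have hGc : Continuous fun z : ℝ × ℝ =>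
      ∫ x in Ω, primG g (W0.val (u + z.1 • φ + z.2 • ψ) x) :=
    (continuous_integral_primG hg hpN).comp (by fun_prop)
  refine mul_eq_mul_of_eventually_le_of_hasFDerivAt
    (e := fun z : ℝ × ℝ => (∫ x in Ω,
        j (W0.val (u + z.1 • φ + z.2 • ψ) x) ‖W0.grad (u + z.1 • φ + z.2 • ψ) x‖)
      - ∫ x in Ω, primF f ‖x‖ (W0.val (u + z.1 • φ + z.2 • ψ) x)) ?_ hGd hGc hne ?_
  · refine (hJd.sub hFd).congr_fderiv ?_
    ext <;> simp
  · filter_upwards [Metric.ball_mem_nhds (0 : ℝ × ℝ) one_pos] with z hz hKz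
    have hu1 : ∫ x in Ω, primG g (W0.val u x) = 1 := hu.mem
    have hmem : u + z.1 • φ + z.2 • ψ ∈ constraintC p Ω g := by
      simp only [Prod.fst_zero, Prod.snd_zero, zero_smul, add_zero] at hKz
      exact hKz.trans hu1
    have hle : funcE j f u ≤ funcE j f (u + z.1 • φ + z.2 • ψ) := by
      rw [hu.eq]
      exact iInf₂_le _ hmem
    rw [funcE_eq_coe hj hint, funcE_eq_coe hj (integrableOn_j_of_mem_ball hj hΩ hφ hψ hint hz), EReal.coe_le_coe_iff] at hle
    simpa using hle

end Multiplier

theorem proposition2p9 {N : ℕ} {p : ℝ} [Fact (1 < p)] (hpN : p < N)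
    (Ω : Set (RN N)) (hΩ : Ω = univ ∨ ∃ R > 0, Ω = Metric.ball 0 R)
    (j js jt f : ℝ → ℝ → ℝ) (g : ℝ → ℝ)
    (hj : AssumptionsJ N p j js jt) (hf : AssumptionsF p Ω f) (hg : AssumptionsG N p g) :
    -- the integrals of `F(|x|, u)` and `G(u)` are well defined on the whole space
    (∀ u : W0 p Ω, IntegrableOn (fun x => primF f ‖x‖ (W0.val u x)) Ω ∧
      IntegrableOn (fun x => primG g (W0.val u x)) Ω) ∧
    LowerSemicontinuous (funcEStar j f g : W0 p Ω → EReal) ∧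
    ∀ u : W0 p Ω, IsSolution j f g u →
      ∃ l : ℝ, ∀ φ ∈ testSpaceV u,
        IntegrableOn (fluxTerm jt u φ) Ω ∧
        IntegrableOn (fun x => js (W0.val u x) ‖W0.grad u x‖ * W0.val φ x) Ω ∧
        IntegrableOn (fun x => f ‖x‖ (W0.val u x) * W0.val φ x) Ω ∧
        IntegrableOn (fun x => g (W0.val u x) * W0.val φ x) Ω ∧
        (∫ x in Ω, fluxTerm jt u φ x)
          + (∫ x in Ω, js (W0.val u x) ‖W0.grad u x‖ * W0.val φ x)
          - (∫ x in Ω, f ‖x‖ (W0.val u x) * W0.val φ x)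
          = l * ∫ x in Ω, g (W0.val u x) * W0.val φ x := by
  have hp1 : 1 < p := Fact.out
  have hs := one_lt_sobolevExp hp1 hpN
  have hΩo : IsOpen Ω := by
    rcases hΩ with rfl | ⟨R, -, rfl⟩
    · exact isOpen_univ
    · exact Metric.isOpen_ball
  have Hf := hf.nemytskiiGrowth hpN
  have Hg := hg.nemytskiiGrowth (Ω := Ω)
  refine ⟨fun u => ⟨?_, ?_⟩, lowerSemicontinuous_funcEStar hpN hj hf hg, fun u hu => ?_⟩
  · exact Hf.integrable_primitive hp1 hs (W0.memLp_val u) (W0.memLp_val_sobolevExp hpN u)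
  · exact Hg.integrable_primitive hp1 hs (W0.memLp_val u) (W0.memLp_val_sobolevExp hpN u)
  obtain ⟨ψ, hψ, hne⟩ := exists_mem_testSpaceV_integral_ne_zero hpN hg hu.mem
  refine ⟨((∫ x in Ω, fluxTerm jt u ψ x)
    + (∫ x in Ω, js (W0.val u x) ‖W0.grad u x‖ * W0.val ψ x)
    - ∫ x in Ω, f ‖x‖ (W0.val u x) * W0.val ψ x) / ∫ x in Ω, g (W0.val u x) * W0.val ψ x,
    fun φ hφ => ?_⟩
  obtain ⟨i1, i2⟩ := integrableOn_js_mul_and_fluxTerm hj hΩo hφ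
  refine ⟨i2, i1, ?_, ?_, ?_⟩
  · exact Hf.integrable_mul hp1 hs (W0.memLp_val u) (W0.memLp_val_sobolevExp hpN u)
      (W0.memLp_val φ) (W0.memLp_val_sobolevExp hpN φ)
  · exact Hg.integrable_mul hp1 hs (W0.memLp_val u) (W0.memLp_val_sobolevExp hpN u)
      (W0.memLp_val φ) (W0.memLp_val_sobolevExp hpN φ)
  · rw [div_mul_eq_mul_div, eq_div_iff hne]
    exact hu.mul_eq_mul hpN hΩo hj hf hg hφ hψ hne
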